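/- **Definitions.** For a finite undirected $d$-regular simple graph $G=(V,E)$ and $\emptyset\ne S\subseteq V$ let $\Phi(S)=\frac{|\{(v,u): v\sim u,\ v\in S,\ u\notin S\}|}{|\{(v,u): v\sim u,\ v\in S\}|}$. $G$ is $(\varepsilon,\gamma)$ small-set expanding if $\Phi(S)\ge\gamma$ for every nonempty $S\subseteq V$ with $|S|\le\varepsilon|V|$. In a two-player game $\Psi$ with finite question sets $X,Y$, question pairs $E\subseteq X\times Y$ and finite answer sets $A,B$, a pair $(x,y)\in E$ is drawn uniformly, Alice answers $f(x)\in A$, Bob answers $g(y)\in B$, and they win if $(f(x),g(y))\in\phi_{(x,y)}$, where $\phi_{(x,y)}\subseteq A\times B$ is the constraint of the edge $(x,y)$. The value $\mathsf{val}(\Psi)$ is the maximum winning probability over all pairs $f\colon X\to A$, $g\colon Y\to B$. In the $t$-fold repetition $\Psi^{\otimes t}$ the question pairs are the $((x_1,\dots,x_t),(y_1,\dots,y_t))\in X^t\times Y^t$ with $(x_i,y_i)\in E$ for all $i$, the answers lie in $A^t$ and $B^t$, and the constraint is the conjunction of the $t$ constraints on the coordinates. - A *Unique-Games instance* on $G=(V,E)$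 with finite alphabet $\Sigma$ is the game with $X=Y=V$, $A=B=\Sigma$, in which $(u,v)$ is a uniformly random ordered pair of adjacent vertices and every constraint $\phi_{(u,v)}\subseteq\Sigma\times\Sigma$ is a one-to-one relation. - A *projection game* is a game in which, for every $(x,y)\in E$, there is a (possibly partial) function $\pi_{x,y}$ from $A$ to $B$ such that $(a,b)\in\phi_{(x,y)}$ if and only if $\pi_{x,y}(a)=b$. Its graph is the bipartite graph on $X\sqcup Y$ with edge set $E$. **Theorem.** There is an absolute constant $c>0$ such that the following holds for all $0<\varepsilon,\gamma,\delta<1$. Let $\Psi$ be either a Unique-Games instance on a regular, $(\varepsilon,\gamma)$ small-set expanding graph, or a projection game whose bipartite graph is regular and $(\varepsilon,\gamma)$ small-set expanding. If $\mathsf{val}(\Psi)\le 1-\delta$, then for every $t\in\mathbb N$ $$\mathsf{val}(\Psi^{\otimes t})\le(1-\delta)^{c\,\varepsilon^3\gamma^3\,t}.$$ -/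

import Mathlib

noncomputable section

/-- The edge expansion `Φ(S)`: among the pairs `(v, u)` of adjacent vertices with `v ∈ S`,
the fraction of those with `u ∉ S`. -/
def edgeExpansion {V : Type*} [Fintype V] (G : SimpleGraph V) (S : Finset V) : ℝ :=
  (Set.ncard {p : V × V | G.Adj p.1 p.2 ∧ p.1 ∈ S ∧ p.2 ∉ S} : ℝ) /
    (Set.ncard {p : V × V | G.Adj p.1 p.2 ∧ p.1 ∈ S} : ℝ)

/-- `G` is `(ε, γ)` small-set expanding: every nonempty set of at most `ε |V|` vertices has
edge expansion at least `γ`. -/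
def IsSmallSetExpander {V : Type*} [Fintype V] (G : SimpleGraph V) (ε γ : ℝ) : Prop :=
  ∀ S : Finset V, S.Nonempty → (S.card : ℝ) ≤ ε * (Fintype.card V : ℝ) → γ ≤ edgeExpansion G S

/-- A two-player one-round game. The referee draws `(x, y)` uniformly from the set `edges` of
question pairs and sends `x` to Alice, `y` to Bob; they answer `a` and `b` without
communicating and win if `accept x y a b`. -/
structure TwoPlayerGame (X Y A B : Type*) where
  edges : Set (X × Y)
  accept : X → Y → A → B → Prop

namespace TwoPlayerGame

variable {X Y A B : Type*}

/-- The probability that the strategies `f` (Alice) and `g` (Bob) win, that is, the fraction of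
constraints satisfied by the labelling that `f` and `g` form together. -/
def winProb (Ψ : TwoPlayerGame X Y A B) (f : X → A) (g : Y → B) : ℝ :=
  (Set.ncard {q ∈ Ψ.edges | Ψ.accept q.1 q.2 (f q.1) (g q.2)} : ℝ) / (Ψ.edges.ncard : ℝ)

/-- The value of the game: the maximum winning probability over all pairs of strategies. -/
def value (Ψ : TwoPlayerGame X Y A B) : ℝ :=
  ⨆ s : (X → A) × (Y → B), Ψ.winProb s.1 s.2

/-- The `t`-fold parallel repetition `Ψ^{⊗ t}`: `t` independent question pairs are asked at
once, and the players win if they win in all `t` coordinates. -/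
def repetition (Ψ : TwoPlayerGame X Y A B) (t : ℕ) :
    TwoPlayerGame (Fin t → X) (Fin t → Y) (Fin t → A) (Fin t → B) where
  edges := {q | ∀ i, (q.1 i, q.2 i) ∈ Ψ.edges}
  accept x y a b := ∀ i, Ψ.accept (x i) (y i) (a i) (b i)

/-- The bipartite graph of the game, with the questions of Alice on one side and those of Bob
on the other. -/
def graph (Ψ : TwoPlayerGame X Y A B) : SimpleGraph (X ⊕ Y) :=
  SimpleGraph.fromRel fun p q => ∃ e ∈ Ψ.edges, p = Sum.inl e.1 ∧ q = Sum.inr e.2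

/-- A projection game: on each edge, the constraint says `b = π a` for a function `π`
from the answers of Alice to those of Bob. The function may be partial (an answer `a` outside
its domain loses), so that games with one-to-one relations are included; the usual projection
games are those in which it is total. -/
def IsProjection (Ψ : TwoPlayerGame X Y A B) : Prop :=
  ∀ x y, (x, y) ∈ Ψ.edges → ∃ π : A → Option B, ∀ a b, Ψ.accept x y a b ↔ π a = some b

end TwoPlayerGame

/-- A Unique-Games instance on the graph `G` with alphabet `A`: for each pair `(u, v)` of
adjacent vertices a one-to-one relation `constraint u v` on the alphabet. (A constraint attached
to an undirected edge is the case in which `constraint v u` is the converse of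
`constraint u v`.) -/
structure UniqueGame {V : Type*} (G : SimpleGraph V) (A : Type*) where
  constraint : V → V → A → A → Prop
  right_unique : ∀ u v, G.Adj u v → ∀ a b b', constraint u v a b → constraint u v a b' → b = b'
  left_unique : ∀ u v, G.Adj u v → ∀ a a' b, constraint u v a b → constraint u v a' b → a = a'

/-- The two-player game of a Unique-Games instance: `(u, v)` is a uniformly random pair of
adjacent vertices, Alice labels `u`, Bob labels `v`. -/
def UniqueGame.game {V : Type*} {G : SimpleGraph V} {A : Type*} (Ψ : UniqueGame G A) :
    TwoPlayerGame V V A A where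
  edges := {q | G.Adj q.1 q.2}
  accept := Ψ.constraint

end

/-! View a game as a nonnegative kernel `K` sending a fractional labelling `q` of Alice's questions
to a function `gameOp K q` on pairs `(y, b)`. The collision value of `q` is the squared norm of this
function, divided by `|Y| d ^ 2`; it is the chance that two random neighbours of a random `y`
project to the same answer. In a projection game the best collision value lies between the square of
the value (Cauchy-Schwarz over `y`) and the value (best responses), so it suffices to control
collision values.

Relax further to vector labellings, families `F ω` with `∑ ω, (∑ a, F ω x a) ^ 2 ≤ 1` at every `x`.
A bound on their collision value is multiplicative: after applying the kernel to all coordinates but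
one, a labelling of the repeated game becomes a vector labelling of the base game, indexed by the
outcomes `(y, b)` of the other coordinates (`sum_gameOp_tensorKernel_sq_le`).

It remains to bound vector labellings of one game, that is, to round them to fractional ones. The
tool is a derandomized correlated sampling (`exists_fractional_labelling`): `ω` selects `x`
according to a weight, and a selected vertex takes its label from `F ω`. With weight `g ^ 2`, where
`g` is the norm, Cauchy-Schwarz gives collision value `ρ ^ 2 / 4` from `ρ`, which is useful when the
value is small. When the value is near `1` a loss linear in `1 - ρ` is needed, but `g ^ 2` may vary
across edges by about the square root of the energy of `g`. On a small-set expander one replaces `t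
^ 2` by `ψ t`, the integral of the distance to about `1 / ε` break points that cut the values of `g`
into small cells. It is comparable to `t ^ 2`, and a Cheeger argument inside each cell bounds its
variation linearly by the energy (`exists_profile`). The two bounds are combined in
`le_rpow_of_collision_bounds`.

A Unique Game is a projection game on the bipartite double cover, which inherits small-set expansion
with `ε / 2`. -/

/-! ### Layer-cake summation and correlated sampling -/

open Finset in
/-- Layer-cake induction: a nonnegative function on a finite type is built from `0` by adding
positive multiples of indicators of sets containing the support. -/
theorem layer_induction {W : Type*} [Fintype W] [DecidableEq W] {P : (W → ℝ) → Prop}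
    (zero : P 0)
    (add : ∀ (m : ℝ) (S : Finset W) (φ : W → ℝ), 0 < m → S.Nonempty → (∀ w, 0 ≤ φ w) →
      (∀ w, w ∉ S → φ w = 0) → P φ → P (fun w => (if w ∈ S then m else 0) + φ w))
    (φ : W → ℝ) (hφ : ∀ w, 0 ≤ φ w) : P φ := by
  classical
  induction h : #{w | φ w ≠ 0} using Nat.strong_induction_on generalizing φ with
  | _ n ih =>
    subst h
    set S : Finset W := {w | φ w ≠ 0} with hS
    rcases S.eq_empty_or_nonempty with h0 | hne
    · have : φ = 0 := by
        funext w
        by_contra hw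
        have : w ∈ S := by simpa [hS] using hw
        simp [h0] at this
      rw [this]; exact zero
    -- Peel off the bottom layer: subtracting the least positive value on the support removes `w₀`
    -- from it.
    · obtain ⟨w₀, hw₀, hmin⟩ := S.exists_min_image φ hne
      have hm : 0 < φ w₀ := lt_of_le_of_ne (hφ _) (by simpa [hS, eq_comm] using hw₀)
      have hout : ∀ w, w ∉ S → φ w = 0 := fun w hw => by simpa [hS] using hw
      let φ' : W → ℝ := fun w => φ w - if w ∈ S then φ w₀ else 0
      have h' : ∀ w, 0 ≤ φ' w := fun w => by
        by_cases hw : w ∈ S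
        · simpa [φ', hw] using hmin w hw
        · simp [φ', hw, hφ]
      have hout' : ∀ w, w ∉ S → φ' w = 0 := fun w hw => by simp [φ', hw, hout w hw]
      have key := add (φ w₀) S φ' hm hne h' hout' (ih _ ?_ φ' h' rfl)
      · convert key using 2 with w
        simp [φ']
      · apply Finset.card_lt_card
        refine ⟨fun w hw => ?_, fun hsub => ?_⟩
        · by_contra hw'
          simp only [mem_filter, mem_univ, true_and] at hw
          exact hw (hout' w hw')
        · have := hsub hw₀
          simp [φ', hw₀] at this

/-- Weighted form of layer-cake summation, comparing a functional of `min` with one of `max`. -/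
theorem sum_min_le_sum_max {W : Type*} [Fintype W] [DecidableEq W] (b R : W → W → ℝ)
    (φ : W → ℝ) (hφ : ∀ w, 0 ≤ φ w)
    (h : ∀ S : Finset W, S.Nonempty → (∀ w ∈ S, 0 < φ w) →
      ∑ w, ∑ w', (if w ∈ S ∧ w' ∈ S then b w w' else 0) <
        ∑ w, ∑ w', (if w ∈ S ∨ w' ∈ S then R w w' else 0)) :
    ∑ w, ∑ w', min (φ w) (φ w') * b w w' ≤ ∑ w, ∑ w', max (φ w) (φ w') * R w w' ∧
    (φ ≠ 0 → ∑ w, ∑ w', min (φ w) (φ w') * b w w' < ∑ w, ∑ w', max (φ w) (φ w') * R w w') := by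
  revert h
  refine layer_induction (P := fun φ => (∀ S : Finset W, S.Nonempty → (∀ w ∈ S, 0 < φ w) →
      ∑ w, ∑ w', (if w ∈ S ∧ w' ∈ S then b w w' else 0) <
        ∑ w, ∑ w', (if w ∈ S ∨ w' ∈ S then R w w' else 0)) →
    (∑ w, ∑ w', min (φ w) (φ w') * b w w' ≤ ∑ w, ∑ w', max (φ w) (φ w') * R w w' ∧
    (φ ≠ 0 → ∑ w, ∑ w', min (φ w) (φ w') * b w w' <
      ∑ w, ∑ w', max (φ w) (φ w') * R w w'))) ?_ ?_ φ hφ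
  · intro _; simp
  · intro m S φ hm hS hφ hout ih h
    have hpos : ∀ w ∈ S, 0 < (if w ∈ S then m else 0) + φ w := fun w hw => by
      rw [if_pos hw]; linarith [hφ w]
    have ih' := (ih fun S' hS' hpos' => h S' hS' fun w hw => by
      have := hpos' w hw
      dsimp only
      split_ifs <;> linarith).1
    have hlt := h S hS hpos
    -- Since `φ` vanishes off `S`, the new layer is nested with the old ones: the minimum grows by
    -- `m` exactly on pairs inside `S`, the maximum exactly on pairs meeting `S`.
    have e1 : ∑ w, ∑ w', min ((if w ∈ S then m else 0) + φ w) ((if w' ∈ S then m else 0) + φ w')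
        * b w w' = m * ∑ w, ∑ w', (if w ∈ S ∧ w' ∈ S then b w w' else 0) +
          ∑ w, ∑ w', min (φ w) (φ w') * b w w' := by
      simp only [Finset.mul_sum, ← Finset.sum_add_distrib]
      refine Finset.sum_congr rfl fun w _ => Finset.sum_congr rfl fun w' _ => ?_
      by_cases hw : w ∈ S <;> by_cases hw' : w' ∈ S <;> simp only [hw, hw', if_true, if_false,
        and_self, and_true, and_false, mul_zero, zero_add]
      · rw [min_add_add_left]; ring
      · rw [hout w' hw', min_eq_right (by linarith [hφ w]), min_eq_right (hφ w)]
      · rw [hout w hw, min_eq_left (by linarith [hφ w']), min_eq_left (hφ w')]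
    have e2 : ∑ w, ∑ w', max ((if w ∈ S then m else 0) + φ w) ((if w' ∈ S then m else 0) + φ w')
        * R w w' = m * ∑ w, ∑ w', (if w ∈ S ∨ w' ∈ S then R w w' else 0) +
          ∑ w, ∑ w', max (φ w) (φ w') * R w w' := by
      simp only [Finset.mul_sum, ← Finset.sum_add_distrib]
      refine Finset.sum_congr rfl fun w _ => Finset.sum_congr rfl fun w' _ => ?_
      by_cases hw : w ∈ S <;> by_cases hw' : w' ∈ S <;> simp only [hw, hw', if_true, if_false,
        or_self, or_true, or_false, mul_zero, zero_add]
      · rw [max_add_add_left]; ring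
      · rw [hout w' hw', max_eq_left (by linarith [hφ w]), max_eq_left (hφ w)]; ring
      · rw [hout w hw, max_eq_right (by linarith [hφ w']), max_eq_right (hφ w')]; ring
    rw [e1, e2]
    have := mul_lt_mul_of_pos_left hlt hm
    exact ⟨by linarith, fun _ => by linarith⟩

/-- Rounding by correlated sampling. A fractional labelling `p ω` and a weight function `φ ω` are
given for every `ω`. If for each pair of vertices the weight with which both are selected and
agree is at least `R` times the weight with which one of them is selected, then a single
fractional labelling achieves agreement `R` on average. -/
theorem exists_fractional_labelling {X A Ω : Type*} [Fintype X] [Fintype A]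
    [Fintype Ω] (B : X → A → X → A → ℝ) (hB : ∀ x a x' a', 0 ≤ B x a x' a')
    (p : Ω → X → A → ℝ) (hp : ∀ ω x a, 0 ≤ p ω x a) (hp1 : ∀ ω x, ∑ a, p ω x a ≤ 1)
    (φ : Ω → X → ℝ) (hφ : ∀ ω x, 0 ≤ φ ω x) (R : X → X → ℝ)
    (hR : ∀ x x', (∑ ω, max (φ ω x) (φ ω x')) * R x x' ≤
      ∑ ω, min (φ ω x) (φ ω x') * ∑ a, ∑ a', B x a x' a' * p ω x a * p ω x' a')
    (hR0 : ∀ x x', (∀ ω, φ ω x = 0) → R x x' = 0) (hR0' : ∀ x x', (∀ ω, φ ω x' = 0) → R x x' = 0) :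
    ∃ q : X → A → ℝ, (∀ x a, 0 ≤ q x a) ∧ (∀ x, ∑ a, q x a ≤ 1) ∧
      ∑ x, ∑ x', R x x' ≤ ∑ x, ∑ x', ∑ a, ∑ a', B x a x' a' * q x a * q x' a' := by
  classical
  -- Greedy form of the sampling: `U` is the set of vertices not yet labelled.
  have main : ∀ U : Finset X, (∀ x ∈ U, ∃ ω, φ ω x ≠ 0) → ∃ q : X → A → ℝ, (∀ x a, 0 ≤ q x a) ∧
      (∀ x, ∑ a, q x a ≤ 1) ∧ ∑ x ∈ U, ∑ x' ∈ U, R x x' ≤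
        ∑ x ∈ U, ∑ x' ∈ U, ∑ a, ∑ a', B x a x' a' * q x a * q x' a' := by
    intro U
    induction U using Finset.strongInduction with
    | H U ih =>
      intro hU
      rcases U.eq_empty_or_nonempty with rfl | hne
      · exact ⟨0, by simp, by simp, by simp⟩
      let b : Ω → X → X → ℝ := fun ω x x' => ∑ a, ∑ a', B x a x' a' * p ω x a * p ω x' a'
      -- Some superlevel set `S` of some `φ ω` is worth labelling by `p ω`: the agreement inside `S`
      -- pays for all pairs of `U` that meet `S`. Otherwise layer-cake summation, added up over `ω`,
      -- contradicts `hR`.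
      have hex : ∃ ω, ∃ S : Finset X, S.Nonempty ∧ S ⊆ U ∧
          ∑ x ∈ U, ∑ x' ∈ U, (if x ∈ S ∨ x' ∈ S then R x x' else 0) ≤
            ∑ x ∈ U, ∑ x' ∈ U, (if x ∈ S ∧ x' ∈ S then b ω x x' else 0) := by
        by_contra hcon
        push Not at hcon
        have hlay : ∀ ω, _ := fun ω => sum_min_le_sum_max
          (fun x x' => if x ∈ U ∧ x' ∈ U then b ω x x' else 0)
          (fun x x' => if x ∈ U ∧ x' ∈ U then R x x' else 0)
          (fun x => if x ∈ U then φ ω x else 0)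
          (fun x => by split_ifs; exacts [hφ _ _, le_rfl]) (fun S hS hSpos => by
            have hSU : S ⊆ U := fun x hx => by
              by_contra hxU
              have := hSpos x hx
              simp [hxU] at this
            have := hcon ω S hS hSU
            have z : ∀ (P : X → X → Prop) [∀ x x', Decidable (P x x')] (f : X → X → ℝ),
                ∑ x, ∑ x', (if P x x' then (if x ∈ U ∧ x' ∈ U then f x x' else 0) else 0) =
                ∑ x ∈ U, ∑ x' ∈ U, (if P x x' then f x x' else 0) := by
              intro P _ f
              rw [← Finset.sum_subset (Finset.subset_univ U)]
              · refine Finset.sum_congr rfl fun x hx => ?_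
                rw [← Finset.sum_subset (Finset.subset_univ U)]
                · refine Finset.sum_congr rfl fun x' hx' => ?_
                  simp [hx, hx']
                · intro x' _ hx'; simp [hx']
              · intro x _ hx; simp [hx]
            rw [z, z]
            exact this)
        obtain ⟨x₀, hx₀⟩ := hne
        obtain ⟨ω₀, hω₀⟩ := hU x₀ hx₀
        have hlt : ∑ ω, ∑ w, ∑ w', min (if w ∈ U then φ ω w else 0) (if w' ∈ U then φ ω w' else 0)
            * (if w ∈ U ∧ w' ∈ U then b ω w w' else 0) <
            ∑ ω, ∑ w, ∑ w', max (if w ∈ U then φ ω w else 0) (if w' ∈ U then φ ω w' else 0)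
            * (if w ∈ U ∧ w' ∈ U then R w w' else 0) := by
          refine Finset.sum_lt_sum (fun ω _ => (hlay ω).1) ⟨ω₀, Finset.mem_univ _, (hlay ω₀).2 ?_⟩
          intro h0
          have := congrFun h0 x₀
          simp [hx₀] at this
          exact hω₀ this
        refine absurd hlt (not_lt.2 ?_)
        rw [Finset.sum_comm, Finset.sum_comm (s := (Finset.univ : Finset Ω))]
        refine Finset.sum_le_sum fun w _ => ?_
        rw [Finset.sum_comm, Finset.sum_comm (s := (Finset.univ : Finset Ω))]
        refine Finset.sum_le_sum fun w' _ => ?_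
        by_cases hw : w ∈ U ∧ w' ∈ U
        · simp only [hw, and_self, if_true, ← Finset.sum_mul]
          exact hR w w'
        · simp [hw]
      obtain ⟨ω, S, hS, hSU, hgain⟩ := hex
      obtain ⟨q, hq0, hq1, hq⟩ := ih (U \ S) (Finset.sdiff_ssubset hSU hS)
        fun x hx => hU x (Finset.mem_sdiff.1 hx).1
      refine ⟨fun x a => if x ∈ S then p ω x a else q x a, fun x a => by
        dsimp only; split_ifs; exacts [hp _ _ _, hq0 _ _], fun x => by
        by_cases hx : x ∈ S <;> simp [hx, hp1, hq1], ?_⟩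
      have zz : ∀ f : X → X → ℝ, ∑ x ∈ U \ S, ∑ x' ∈ U \ S, f x x' =
          ∑ x ∈ U, ∑ x' ∈ U, (if x ∉ S ∧ x' ∉ S then f x x' else 0) := by
        intro f
        rw [Finset.sdiff_eq_filter, Finset.sum_filter]
        refine Finset.sum_congr rfl fun x _ => ?_
        by_cases hx : x ∈ S <;> simp [hx, Finset.sum_filter]
      rw [zz, zz] at hq
      calc ∑ x ∈ U, ∑ x' ∈ U, R x x' =
          ∑ x ∈ U, ∑ x' ∈ U, (if x ∈ S ∨ x' ∈ S then R x x' else 0) +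
          ∑ x ∈ U, ∑ x' ∈ U, (if x ∉ S ∧ x' ∉ S then R x x' else 0) := by
            simp only [← Finset.sum_add_distrib]
            refine Finset.sum_congr rfl fun x _ => Finset.sum_congr rfl fun x' _ => ?_
            by_cases hx : x ∈ S <;> by_cases hx' : x' ∈ S <;> simp [hx, hx']
        _ ≤ _ := add_le_add hgain hq
        _ ≤ _ := by
            simp only [← Finset.sum_add_distrib]
            refine Finset.sum_le_sum fun x _ => Finset.sum_le_sum fun x' _ => ?_
            by_cases hx : x ∈ S <;> by_cases hx' : x' ∈ S <;> simp only [hx, hx', b, and_self,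
              and_true, and_false, if_true, if_false, not_true, not_false_iff, add_zero, zero_add,
              le_refl]
            · exact Finset.sum_nonneg fun a _ => Finset.sum_nonneg fun a' _ =>
                mul_nonneg (mul_nonneg (hB _ _ _ _) (hp _ _ _)) (hq0 _ _)
            · exact Finset.sum_nonneg fun a _ => Finset.sum_nonneg fun a' _ =>
                mul_nonneg (mul_nonneg (hB _ _ _ _) (hq0 _ _)) (hp _ _ _)
  obtain ⟨q, h0, h1, h⟩ := main {x | ∃ ω, φ ω x ≠ 0} (by simp)
  refine ⟨q, h0, h1, ?_⟩
  have hpos : ∀ x x', 0 ≤ ∑ a, ∑ a', B x a x' a' * q x a * q x' a' := fun x x' =>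
    Finset.sum_nonneg fun a _ => Finset.sum_nonneg fun a' _ =>
      mul_nonneg (mul_nonneg (hB _ _ _ _) (h0 _ _)) (h0 _ _)
  calc ∑ x, ∑ x', R x x' = _ := by
        symm
        rw [Finset.sum_subset (Finset.subset_univ _)]
        · refine Finset.sum_congr rfl fun x _ => Finset.sum_subset (Finset.subset_univ _) ?_
          intro x' _ hx'
          exact hR0' x x' (by simpa using hx')
        · intro x _ hx
          exact Finset.sum_eq_zero fun x' _ => hR0 x x' (by simpa using hx)
    _ ≤ _ := h
    _ ≤ _ := by
        refine (Finset.sum_le_sum fun x _ => Finset.sum_le_sum_of_subset_of_nonneg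
          (Finset.subset_univ _) fun x' _ _ => hpos x x').trans ?_
        exact Finset.sum_le_sum_of_subset_of_nonneg (Finset.subset_univ _)
          fun x _ _ => Finset.sum_nonneg fun x' _ => hpos x x'

/-! ### Break points -/

/-- A choice of few break points such that few of the values lie strictly between two
consecutive ones. -/
theorem exists_breakpoints {W : Type*} [Fintype W] [DecidableEq W] (u : W → ℝ) (m : ℕ)
    (hm : 0 < m) (P : Finset W) :
    ∃ T : Finset ℝ, T.card * m ≤ P.card ∧ (∀ τ ∈ T, ∃ w ∈ P, u w = τ) ∧
      ∀ T₀ : Finset ℝ, (P.filter fun w => u w ∉ T ∧ T.filter (· < u w) = T₀).card < m := by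
  induction h : P.card using Nat.strong_induction_on generalizing P with
  | _ n ih =>
    subst h
    by_cases hP : P.card < m
    · exact ⟨∅, by simp, by simp, fun T₀ => (Finset.card_filter_le _ _).trans_lt hP⟩
    push Not at hP
    have hne : P.Nonempty := Finset.card_pos.1 (hm.trans_le hP)
    obtain ⟨wM, hwM, hmax⟩ := P.exists_max_image u hne
    -- The first break point is the least value `u w₀` with at least `m` elements at or below it.
    -- Fewer than `m` lie strictly below, and at least `m` elements are used up before recursing on
    -- those above.
    have hne' : (P.filter fun w => m ≤ (P.filter fun w' => u w' ≤ u w).card).Nonempty :=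
      ⟨wM, Finset.mem_filter.2 ⟨hwM, by rwa [Finset.filter_true_of_mem hmax]⟩⟩
    obtain ⟨w₀, hw₀, hmin⟩ := Finset.exists_min_image _ u hne'
    obtain ⟨hw₀P, hw₀m⟩ := Finset.mem_filter.1 hw₀
    have hlow : (P.filter fun w => u w < u w₀).card < m := by
      rcases (P.filter fun w => u w < u w₀).eq_empty_or_nonempty with h0 | h1
      · simpa [h0] using hm
      · obtain ⟨w₁, hw₁, hmax₁⟩ := Finset.exists_max_image _ u h1
        obtain ⟨hw₁P, hw₁u⟩ := Finset.mem_filter.1 hw₁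
        by_contra hge
        push Not at hge
        have : w₁ ∈ P.filter fun w => m ≤ (P.filter fun w' => u w' ≤ u w).card := by
          refine Finset.mem_filter.2 ⟨hw₁P, hge.trans (Finset.card_le_card fun w hw => ?_)⟩
          exact Finset.mem_filter.2 ⟨(Finset.mem_filter.1 hw).1, hmax₁ w hw⟩
        linarith [hmin w₁ this]
    set P' := P.filter fun w => u w₀ < u w with hP'
    have hcard : P'.card + (P.filter fun w' => u w' ≤ u w₀).card = P.card := by
      rw [add_comm, hP']
      simpa only [not_le] using
        Finset.card_filter_add_card_filter_not (s := P) (fun w' => u w' ≤ u w₀)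
    obtain ⟨T, hT, hTP, hTcell⟩ := ih P'.card (by omega) P' rfl
    have hgt : ∀ τ ∈ T, u w₀ < τ := fun τ hτ => by
      obtain ⟨w, hw, rfl⟩ := hTP τ hτ
      exact (Finset.mem_filter.1 hw).2
    refine ⟨insert (u w₀) T, ?_, ?_, fun T₀ => ?_⟩
    · have := Finset.card_insert_le (u w₀) T
      nlinarith
    · intro τ hτ
      rcases Finset.mem_insert.1 hτ with rfl | hτ
      · exact ⟨w₀, hw₀P, rfl⟩
      · obtain ⟨w, hw, rfl⟩ := hTP τ hτ
        exact ⟨w, (Finset.mem_filter.1 hw).1, rfl⟩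
    -- A cell is recorded by the set `T₀` of break points below it: it lies above `u w₀` and comes
    -- from the recursion, or it is the bottom cell.
    · by_cases h0 : u w₀ ∈ T₀
      · refine (Finset.card_le_card fun w hw => ?_).trans_lt (hTcell (T₀.erase (u w₀)))
        simp only [Finset.mem_filter, Finset.mem_insert, not_or] at hw ⊢
        obtain ⟨hwP, ⟨hw1, hw2⟩, rfl⟩ := hw
        have hlt : u w₀ < u w := (Finset.mem_filter.1 h0).2
        refine ⟨Finset.mem_filter.2 ⟨hwP, hlt⟩, hw2, ?_⟩
        rw [Finset.filter_insert, if_pos hlt, Finset.erase_insert]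
        intro hmem
        exact lt_irrefl _ (hgt _ (Finset.mem_filter.1 hmem).1)
      · refine (Finset.card_le_card fun w hw => ?_).trans_lt hlow
        simp only [Finset.mem_filter, Finset.mem_insert, not_or] at hw ⊢
        obtain ⟨hwP, ⟨hw1, hw2⟩, rfl⟩ := hw
        refine ⟨hwP, lt_of_le_of_ne (not_lt.1 fun hlt => h0 ?_) hw1⟩
        simp [hlt]

/-! ### Integrals of the distance to a finite set -/

section Distance

open Metric

/-- The distance is `1`-Lipschitz, so between `a` and `b` the integrand exceeds its value at `a` by
at most `|a - b|`. -/
theorem abs_integral_infDist_sub_le (T : Set ℝ) (a b : ℝ) :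
    |(∫ s in (0:ℝ)..a, infDist s T) - ∫ s in (0:ℝ)..b, infDist s T| ≤
      |a - b| * (infDist a T + |a - b|) := by
  have hc : Continuous fun s : ℝ => infDist s T := continuous_infDist_pt T
  rw [intervalIntegral.integral_interval_sub_left (hc.intervalIntegrable _ _)
    (hc.intervalIntegrable _ _)]
  have := intervalIntegral.norm_integral_le_of_norm_le_const (a := b) (b := a)
    (f := fun s => infDist s T) (C := infDist a T + |a - b|) (fun s hs => by
      rw [Real.norm_of_nonneg infDist_nonneg]
      refine (infDist_le_infDist_add_dist (y := a)).trans (add_le_add le_rfl ?_)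
      rw [Real.dist_eq]
      have := Set.uIoc_subset_uIcc hs
      rw [Set.mem_uIcc] at this
      rcases this with h | h
      · rw [abs_sub_comm, abs_of_nonneg (by linarith), abs_of_nonneg (by linarith)]; linarith
      · rw [abs_of_nonneg (by linarith), abs_sub_comm, abs_of_nonneg (by linarith)]; linarith)
  rw [Real.norm_eq_abs] at this
  linarith

theorem integral_infDist_le {T : Set ℝ} (h0 : (0:ℝ) ∈ T) {t : ℝ} (ht : 0 ≤ t) :
    ∫ s in (0:ℝ)..t, infDist s T ≤ t ^ 2 / 2 := by
  have hc : Continuous fun s : ℝ => infDist s T := continuous_infDist_pt T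
  have : ∫ s in (0:ℝ)..t, infDist s T ≤ ∫ s in (0:ℝ)..t, s := by
    refine intervalIntegral.integral_mono_on ht (hc.intervalIntegrable _ _)
      (continuous_id.intervalIntegrable _ _) fun s hs => ?_
    refine (infDist_le_dist_of_mem h0).trans ?_
    rw [Real.dist_eq, sub_zero, abs_of_nonneg hs.1]
  simpa using this

theorem integral_tent_le (h τ t : ℝ) (hh : 0 ≤ h) (ht : 0 ≤ t) :
    ∫ s in (0:ℝ)..t, max 0 (h - |s - τ|) ≤ 2 * h ^ 2 := by
  have hcont : Continuous fun s : ℝ => max 0 (h - |s - τ|) := by fun_prop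
  have h1 : ∫ s in (0:ℝ)..t, max 0 (h - |s - τ|) ≤
      ∫ s in Set.Icc (τ - h) (τ + h), max 0 (h - |s - τ|) := by
    rw [intervalIntegral.integral_of_le ht]
    rw [← MeasureTheory.setIntegral_eq_of_subset_of_forall_sdiff_eq_zero
      (s := Set.Icc (τ - h) (τ + h)) (t := Set.Icc (τ - h) (τ + h) ∪ Set.Ioc 0 t)
      (by measurability) Set.subset_union_left]
    · refine MeasureTheory.setIntegral_mono_set ?_ ?_ ?_
      · exact (hcont.integrableOn_Icc).union (hcont.integrableOn_Icc.mono_set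
          Set.Ioc_subset_Icc_self)
      · exact Filter.Eventually.of_forall fun s => le_max_left _ _
      · exact Set.subset_union_right.eventuallyLE
    · intro s hs
      refine max_eq_left ?_
      have := hs.2
      rw [Set.mem_Icc] at this
      by_contra hcon
      push Not at hcon
      have := abs_le.1 (show |s - τ| ≤ h by linarith)
      exact hs.2 ⟨by linarith, by linarith⟩
  refine h1.trans ?_
  have h2 : ∫ s in Set.Icc (τ - h) (τ + h), max 0 (h - |s - τ|) ≤
      ∫ s in Set.Icc (τ - h) (τ + h), h := by
    refine MeasureTheory.setIntegral_mono hcont.integrableOn_Icc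
      (continuous_const.integrableOn_Icc) fun s => ?_
    exact max_le hh (by linarith [abs_nonneg (s - τ)])
  refine h2.trans (le_of_eq ?_)
  simp [Real.volume_real_Icc]
  rw [max_eq_left (by linarith)]
  ring

/-- The distance is at least `h` minus the sum of the tents of height `h` at the points of `T`, so
few points cannot make it small on most of the interval. -/
theorem le_integral_infDist {T : Finset ℝ} (hT : T.Nonempty) {t : ℝ} (ht : 0 ≤ t) :
    t ^ 2 / (8 * T.card) ≤ ∫ s in (0:ℝ)..t, infDist s (T : Set ℝ) := by
  have hk : (0:ℝ) < T.card := by exact_mod_cast Finset.card_pos.2 hT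
  -- This `h` maximizes `t * h - 2 * T.card * h ^ 2`.
  set h : ℝ := t / (4 * T.card) with hh
  have h0 : 0 ≤ h := by positivity
  have hc : Continuous fun s : ℝ => infDist s (T : Set ℝ) := continuous_infDist_pt _
  have hct : ∀ τ, Continuous fun s : ℝ => max 0 (h - |s - τ|) := fun τ => by fun_prop
  have h1 : ∫ s in (0:ℝ)..t, (h - ∑ τ ∈ T, max 0 (h - |s - τ|)) ≤
      ∫ s in (0:ℝ)..t, infDist s (T : Set ℝ) := by
    refine intervalIntegral.integral_mono_on ht (Continuous.intervalIntegrable (by fun_prop) _ _)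
      (hc.intervalIntegrable _ _) fun s _ => ?_
    obtain ⟨τ, hτ, hd⟩ := T.finite_toSet.isCompact.exists_infDist_eq_dist
      (by simpa using hT) s
    have := Finset.single_le_sum (f := fun τ => max 0 (h - |s - τ|))
      (fun τ _ => le_max_left _ _) hτ
    have h2 : h - |s - τ| ≤ max 0 (h - |s - τ|) := le_max_right _ _
    rw [hd, Real.dist_eq]
    linarith
  refine le_trans ?_ h1
  rw [intervalIntegral.integral_sub (by simp)
    (Continuous.intervalIntegrable (by fun_prop) _ _),
    intervalIntegral.integral_finsetSum fun τ _ => (hct τ).intervalIntegrable _ _]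
  have h3 : ∑ τ ∈ T, ∫ s in (0:ℝ)..t, max 0 (h - |s - τ|) ≤ T.card * (2 * h ^ 2) := by
    rw [← nsmul_eq_mul]
    exact Finset.sum_le_card_nsmul _ _ _ fun τ _ => integral_tent_le h τ t h0 ht
  have h4 : t ^ 2 / (8 * T.card) = t * h - T.card * (2 * h ^ 2) := by
    rw [hh]; field_simp; ring
  simp only [intervalIntegral.integral_const, sub_zero, smul_eq_mul]
  linarith

end Distance

/-! ### A Cheeger inequality for small cells -/

section Cheeger

open Metric

variable {W : Type*} [Fintype W] [DecidableEq W]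

/-- The total weight of the edges leaving `S`. -/
def cutWeight (k : W → W → ℝ) (S : Finset W) : ℝ :=
  ∑ w, ∑ w', if w ∈ S ∧ w' ∉ S then k w w' else 0

/-- The coarea inequality for functions all of whose superlevel sets expand. -/
theorem coarea_le (k : W → W → ℝ) (c : ℝ) (φ : W → ℝ) (hφ : ∀ w, 0 ≤ φ w)
    (h : ∀ S : Finset W, (∀ w ∈ S, 0 < φ w) → c * S.card ≤ cutWeight k S) :
    c * ∑ w, φ w ≤ ∑ w, ∑ w', k w w' * max (φ w - φ w') 0 := by
  revert h
  refine layer_induction (P := fun φ => (∀ S : Finset W, (∀ w ∈ S, 0 < φ w) →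
    c * S.card ≤ cutWeight k S) → c * ∑ w, φ w ≤ ∑ w, ∑ w', k w w' * max (φ w - φ w') 0)
    ?_ ?_ φ hφ
  · intro _; simp
  · intro m S φ hm hS hφ hout ih h
    have ih' := ih fun S' hS' => h S' fun w hw => by
      have := hS' w hw
      dsimp only
      split_ifs <;> linarith
    have hS' := h S fun w hw => by
      dsimp only
      rw [if_pos hw]; linarith [hφ w]
    have e1 : ∑ w, ∑ w', k w w' * max (((if w ∈ S then m else 0) + φ w) -
        ((if w' ∈ S then m else 0) + φ w')) 0 =
        m * cutWeight k S + ∑ w, ∑ w', k w w' * max (φ w - φ w') 0 := by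
      simp only [cutWeight, Finset.mul_sum, ← Finset.sum_add_distrib]
      refine Finset.sum_congr rfl fun w _ => Finset.sum_congr rfl fun w' _ => ?_
      by_cases hw : w ∈ S <;> by_cases hw' : w' ∈ S <;> simp only [hw, hw', if_true, if_false,
        not_true, not_false_iff, and_self, and_true, and_false, mul_zero, zero_add]
      · rw [add_sub_add_left_eq_sub]
      · rw [hout w' hw', sub_zero, sub_zero, max_eq_left (hφ w),
          max_eq_left (by linarith [hφ w])]
        ring
      · rw [hout w hw, max_eq_right (by linarith [hφ w']), max_eq_right (by linarith [hφ w'])]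
    rw [e1, Finset.sum_add_distrib, mul_add]
    refine add_le_add ?_ ih'
    have : ∑ w, (if w ∈ S then m else 0) = m * S.card := by
      simp [mul_comm]
    rw [this]
    calc c * (m * S.card) = m * (c * S.card) := by ring
      _ ≤ _ := mul_le_mul_of_nonneg_left hS' hm.le

/-- The coarea inequality for the square of a function, applied in each cell of a partition. -/
theorem coarea_sq_le {ι : Type*} [DecidableEq ι] (k : W → W → ℝ)
    (c : ℝ) (r : W → ℝ) (κ : W → ι)
    (h : ∀ (i : ι) (S : Finset W), (∀ w ∈ S, r w ≠ 0 ∧ κ w = i) → c * S.card ≤ cutWeight k S) :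
    c * ∑ w, r w ^ 2 ≤
      ∑ w, ∑ w', k w w' * if κ w = κ w' then max (r w ^ 2 - r w' ^ 2) 0 else r w ^ 2 := by
  -- Each superlevel set of `φ i` stays in cell `i`. An edge between two cells is charged the full
  -- `r w ^ 2`.
  let φ : ι → W → ℝ := fun i w => if κ w = i then r w ^ 2 else 0
  have hφ : ∀ i w, 0 ≤ φ i w := fun i w => by
    dsimp only [φ]; split_ifs <;> positivity
  have hco : ∀ i, c * ∑ w, φ i w ≤ ∑ w, ∑ w', k w w' * max (φ i w - φ i w') 0 := fun i =>
    coarea_le k c (φ i) (hφ i) fun S hS => h i S fun w hw => by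
      have := hS w hw
      dsimp only [φ] at this
      split_ifs at this with h1
      · exact ⟨fun h0 => by simp [h0] at this, h1⟩
      · exact absurd this (lt_irrefl _)
  have hsum := Finset.sum_le_sum fun i (_ : i ∈ Finset.univ.image κ) => hco i
  rw [← Finset.mul_sum, Finset.sum_comm, Finset.sum_comm (s := Finset.univ.image κ)] at hsum
  have hmem : ∀ w, κ w ∈ Finset.univ.image κ := fun w =>
    Finset.mem_image_of_mem _ (Finset.mem_univ _)
  have e1 : ∀ w, ∑ i ∈ Finset.univ.image κ, φ i w = r w ^ 2 := fun w => by
    rw [Finset.sum_eq_single_of_mem (κ w) (hmem w)]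
    · simp [φ]
    · intro i _ hi; simp [φ, hi.symm]
  simp only [e1] at hsum
  refine hsum.trans (Finset.sum_le_sum fun w _ => ?_)
  rw [Finset.sum_comm]
  refine Finset.sum_le_sum fun w' _ => le_of_eq ?_
  rw [← Finset.mul_sum, Finset.sum_eq_single_of_mem (κ w) (hmem w)]
  · by_cases hκ : κ w = κ w'
    · simp [φ, hκ]
    · simp [φ, hκ, Ne.symm hκ, sq_nonneg]
  · intro i _ hi
    have : φ i w = 0 := by simp [φ, hi.symm]
    rw [this]
    exact max_eq_right (by linarith [hφ i w'])

/-- In a small-set expander, the vertices whose values are separated by break points into small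
cells have values close to the break points. -/
theorem sum_sq_infDist_le (k : W → W → ℝ) (hk : ∀ w w', 0 ≤ k w w')
    (hsymm : ∀ w w', k w w' = k w' w) {d γ : ℝ} (hγ : 0 < γ) (hd : ∀ w, ∑ w', k w w' = d)
    (u : W → ℝ) (T : Finset ℝ)
    (h : ∀ (T₀ : Finset ℝ) (S : Finset W), (∀ w ∈ S, u w ∉ T ∧ T.filter (· < u w) = T₀) →
      γ * d * S.card ≤ cutWeight k S) :
    γ ^ 2 * (d * ∑ w, infDist (u w) (T : Set ℝ) ^ 2) ≤
      4 * ∑ w, ∑ w', k w w' * (u w - u w') ^ 2 := by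
  set r : W → ℝ := fun w => infDist (u w) (T : Set ℝ) with hr
  have hr0 : ∀ w, 0 ≤ r w := fun w => infDist_nonneg
  have h1 := coarea_sq_le k (γ * d) r (fun w => T.filter (· < u w)) fun T₀ S hS =>
    h T₀ S fun w hw => ⟨fun hmem => (hS w hw).1 (infDist_zero_of_mem (by simpa using hmem)),
      (hS w hw).2⟩
  have hlip : ∀ w w', r w ≤ r w' + |u w - u w'| := fun w w' => by
    simpa [Real.dist_eq] using infDist_le_infDist_add_dist (s := (T : Set ℝ)) (x := u w) (y := u w')
  have hsep : ∀ w w' τ, τ ∈ T → u w ≤ τ → τ < u w' → r w + r w' ≤ |u w - u w'| := by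
    intro w w' τ hτ h1 h2
    have a1 : r w ≤ |u w - τ| := infDist_le_dist_of_mem (by simpa using hτ)
    have a2 : r w' ≤ |u w' - τ| := infDist_le_dist_of_mem (by simpa using hτ)
    rw [abs_of_nonpos (by linarith)] at a1 ⊢
    rw [abs_of_nonneg (by linarith)] at a2
    linarith
  -- Within a cell, `r w ^ 2 - r w' ^ 2` factors and `r` is `1`-Lipschitz in `u`; between cells a
  -- break point separates the values, so `r w + r w' ≤ |u w - u w'|`. Both cases give `|u w - u w'|
  -- * (r w + r w')`. The weights in the AM-GM step let half of the left side of `h2` absorb the `r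
  -- ^ 2` terms.
  have hpt : ∀ w w', (if T.filter (· < u w) = T.filter (· < u w') then
      max (r w ^ 2 - r w' ^ 2) 0 else r w ^ 2) ≤
      2 / γ * (u w - u w') ^ 2 + γ / 4 * (r w ^ 2 + r w' ^ 2) := by
    intro w w'
    have hAM : |u w - u w'| * (r w + r w') ≤
        2 / γ * (u w - u w') ^ 2 + γ / 4 * (r w ^ 2 + r w' ^ 2) := by
      rw [← sq_abs (u w - u w')]
      have e : 2 / γ * |u w - u w'| ^ 2 + γ / 4 * (r w ^ 2 + r w' ^ 2) -
          |u w - u w'| * (r w + r w') =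
          (1 / γ) * ((|u w - u w'| - γ / 2 * r w) ^ 2 + (|u w - u w'| - γ / 2 * r w') ^ 2) := by
        field_simp; ring
      have : 0 ≤ (1 / γ) * ((|u w - u w'| - γ / 2 * r w) ^ 2 +
        (|u w - u w'| - γ / 2 * r w') ^ 2) := by positivity
      linarith
    refine le_trans ?_ hAM
    have habs := abs_nonneg (u w - u w')
    split_ifs with heq
    · refine max_le ?_ (by have := hr0 w; have := hr0 w'; positivity)
      have := hlip w w'
      nlinarith [hr0 w, hr0 w']
    · have hle : r w + r w' ≤ |u w - u w'| := by
        by_contra hcon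
        refine heq (Finset.filter_congr fun τ hτ => ⟨fun hlt => ?_, fun hlt => ?_⟩)
        · by_contra hge
          have := hsep w' w τ hτ (not_lt.1 hge) hlt
          rw [abs_sub_comm] at this
          exact hcon (by linarith)
        · by_contra hge
          exact hcon (hsep w w' τ hτ (not_lt.1 hge) hlt)
      nlinarith [hr0 w, hr0 w']
  have h2 : γ * d * ∑ w, r w ^ 2 ≤
      ∑ w, ∑ w', k w w' * (2 / γ * (u w - u w') ^ 2 + γ / 4 * (r w ^ 2 + r w' ^ 2)) :=
    h1.trans (Finset.sum_le_sum fun w _ => Finset.sum_le_sum fun w' _ =>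
      mul_le_mul_of_nonneg_left (hpt w w') (hk w w'))
  have e1 : ∑ w, ∑ w', k w w' * r w ^ 2 = d * ∑ w, r w ^ 2 := by
    rw [Finset.mul_sum]
    exact Finset.sum_congr rfl fun w _ => by rw [← Finset.sum_mul, hd]
  have e2 : ∑ w, ∑ w', k w w' * r w' ^ 2 = d * ∑ w, r w ^ 2 := by
    rw [Finset.sum_comm, ← e1]
    exact Finset.sum_congr rfl fun w _ => Finset.sum_congr rfl fun w' _ => by rw [hsymm]
  have e3 : ∑ w, ∑ w', k w w' * (2 / γ * (u w - u w') ^ 2 + γ / 4 * (r w ^ 2 + r w' ^ 2)) =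
      2 / γ * (∑ w, ∑ w', k w w' * (u w - u w') ^ 2) +
      γ / 4 * (∑ w, ∑ w', k w w' * r w ^ 2 + ∑ w, ∑ w', k w w' * r w' ^ 2) := by
    simp only [Finset.mul_sum, mul_add, ← Finset.sum_add_distrib]
    exact Finset.sum_congr rfl fun w _ => Finset.sum_congr rfl fun w' _ => by ring
  rw [e3, e1, e2] at h2
  set D := d * ∑ w, r w ^ 2
  set E := ∑ w, ∑ w', k w w' * (u w - u w') ^ 2
  have h3 : γ / 2 * D ≤ 2 / γ * E := by
    have : γ * d * ∑ w, r w ^ 2 = γ * D := by simp only [D]; ring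
    rw [this] at h2; linarith
  have := mul_le_mul_of_nonneg_left h3 (show 0 ≤ 2 * γ by positivity)
  have e : 2 * γ * (2 / γ * E) = 4 * E := by field_simp; ring
  rw [e] at this
  linarith

/-- For a function on a small-set expander there is a profile, comparable to `t ↦ t ^ 2`, whose
level sets are cut in proportion to the energy of the function. -/
theorem exists_profile (k : W → W → ℝ) (hk : ∀ w w', 0 ≤ k w w')
    (hsymm : ∀ w w', k w w' = k w' w) {d ε γ : ℝ} (hε : 0 < ε) (hε1 : ε ≤ 1)
    (hγ : 0 < γ) (hγ1 : γ ≤ 1) (hd : ∀ w, ∑ w', k w w' = d)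
    (hexp : ∀ S : Finset W, (S.card : ℝ) ≤ ε * Fintype.card W → γ * d * S.card ≤ cutWeight k S)
    (u : W → ℝ) :
    ∃ ψ : ℝ → ℝ, (∀ t, 0 ≤ t → ε / 16 * t ^ 2 ≤ ψ t) ∧
      (∀ t, 0 ≤ t → ψ t ≤ t ^ 2 / 2) ∧
      ∑ w, ∑ w', k w w' * |ψ (u w) - ψ (u w')| ≤
        4 / γ * ∑ w, ∑ w', k w w' * (u w - u w') ^ 2 := by
  set n : ℝ := ((Fintype.card W : ℕ) : ℝ) with hn
  have hn0 : 0 ≤ n := by positivity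
  -- Cells with fewer than `⌊ε * n⌋₊ + 1` points are small enough to expand, while at most `1 / ε`
  -- break points are needed. Adding `0` yields the upper bound on the profile and only refines the
  -- cells.
  obtain ⟨T', hT'card, -, hT'⟩ := exists_breakpoints u (⌊ε * n⌋₊ + 1) (by omega) Finset.univ
  set T := insert 0 T' with hT
  have hcard : (T.card : ℝ) ≤ 2 / ε := by
    have h1 : (T.card : ℝ) ≤ T'.card + 1 := by exact_mod_cast Finset.card_insert_le _ _
    have h2 : (T'.card : ℝ) * (⌊ε * n⌋₊ + 1) ≤ n := by
      rw [Finset.card_univ] at hT'card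
      have := (Nat.cast_le (α := ℝ)).2 hT'card
      push_cast at this
      exact this
    have h3 : ε * n < ⌊ε * n⌋₊ + 1 := Nat.lt_floor_add_one _
    have h4 : (T'.card : ℝ) ≤ 1 / ε := by
      rw [le_div_iff₀ hε]
      rcases hn0.eq_or_lt with h0 | hpos
      · rw [← h0] at h2
        have : (0:ℝ) ≤ ⌊ε * n⌋₊ := by positivity
        rw [← h0] at this
        have : (T'.card : ℝ) ≤ 0 := by
          by_contra hc
          push Not at hc
          have : 0 < (T'.card : ℝ) * (⌊ε * 0⌋₊ + 1) := by positivity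
          linarith
        nlinarith
      · have : (T'.card : ℝ) * (ε * n) ≤ n :=
          (mul_le_mul_of_nonneg_left h3.le (by positivity)).trans h2
        by_contra hc
        push Not at hc
        nlinarith
    have h5 : 1 ≤ 1 / ε := by rw [le_div_iff₀ hε]; linarith
    have : 2 / ε = 1 / ε + 1 / ε := by ring
    linarith
  have hne : T.Nonempty := ⟨0, by simp [hT]⟩
  have hcell : ∀ (T₀ : Finset ℝ) (S : Finset W),
      (∀ w ∈ S, u w ∉ T ∧ T.filter (· < u w) = T₀) → γ * d * S.card ≤ cutWeight k S := by
    intro T₀ S hS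
    refine hexp S ?_
    have hlt : S.card < ⌊ε * n⌋₊ + 1 := by
      refine (Finset.card_le_card fun w hw => ?_).trans_lt (hT' (T₀ ∩ T'))
      obtain ⟨h1, h2⟩ := hS w hw
      refine Finset.mem_filter.2 ⟨Finset.mem_univ _, fun hmem => h1 (by simp [hT, hmem]), ?_⟩
      rw [← h2]
      ext τ
      simp only [Finset.mem_filter, Finset.mem_inter, hT, Finset.mem_insert]
      tauto
    have : S.card ≤ ⌊ε * n⌋₊ := by omega
    exact (Nat.cast_le.2 this).trans (Nat.floor_le (by positivity))
  have hsq := sum_sq_infDist_le k hk hsymm hγ hd u T hcell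
  refine ⟨fun t => ∫ s in (0:ℝ)..t, infDist s (T : Set ℝ), ?_, ?_, ?_⟩
  · intro t ht
    refine le_trans ?_ (le_integral_infDist hne ht)
    have hpos : (0:ℝ) < T.card := by exact_mod_cast Finset.card_pos.2 hne
    rw [le_div_iff₀ (by positivity)]
    rw [le_div_iff₀ hε] at hcard
    nlinarith [sq_nonneg t]
  · intro t ht
    exact integral_infDist_le (by simp [hT]) ht
  · set E := ∑ w, ∑ w', k w w' * (u w - u w') ^ 2 with hE
    have hE0 : 0 ≤ E := Finset.sum_nonneg fun w _ => Finset.sum_nonneg fun w' _ =>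
      mul_nonneg (hk _ _) (sq_nonneg _)
    have hpt : ∀ w w', |(∫ s in (0:ℝ)..(u w), infDist s (T : Set ℝ)) -
        ∫ s in (0:ℝ)..(u w'), infDist s (T : Set ℝ)| ≤
        (1 + 1 / (2 * γ)) * (u w - u w') ^ 2 + γ / 2 * infDist (u w) (T : Set ℝ) ^ 2 := by
      intro w w'
      refine (abs_integral_infDist_sub_le _ _ _).trans ?_
      rw [← sq_abs (u w - u w')]
      set x := |u w - u w'|
      set y := infDist (u w) (T : Set ℝ)
      have e : (1 + 1 / (2 * γ)) * x ^ 2 + γ / 2 * y ^ 2 - x * (y + x) =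
          (1 / (2 * γ)) * (x - γ * y) ^ 2 := by field_simp; ring
      have : 0 ≤ (1 / (2 * γ)) * (x - γ * y) ^ 2 := by positivity
      linarith
    calc _ ≤ ∑ w, ∑ w', k w w' * ((1 + 1 / (2 * γ)) * (u w - u w') ^ 2 +
          γ / 2 * infDist (u w) (T : Set ℝ) ^ 2) :=
        Finset.sum_le_sum fun w _ => Finset.sum_le_sum fun w' _ =>
          mul_le_mul_of_nonneg_left (hpt w w') (hk _ _)
      _ = (1 + 1 / (2 * γ)) * E + γ / 2 * (d * ∑ w, infDist (u w) (T : Set ℝ) ^ 2) := by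
        have e1 : d * ∑ w, infDist (u w) (T : Set ℝ) ^ 2 =
            ∑ w, ∑ w', k w w' * infDist (u w) (T : Set ℝ) ^ 2 := by
          rw [Finset.mul_sum]
          exact Finset.sum_congr rfl fun w _ => by rw [← Finset.sum_mul, hd]
        rw [e1, hE]
        simp only [Finset.mul_sum, ← Finset.sum_add_distrib]
        exact Finset.sum_congr rfl fun w _ => Finset.sum_congr rfl fun w' _ => by ring
      _ ≤ 4 / γ * E := by
        set D := d * ∑ w, infDist (u w) (T : Set ℝ) ^ 2
        have h1 : γ / 2 * D ≤ 2 / γ * E := by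
          have := mul_le_mul_of_nonneg_left hsq (show 0 ≤ 1 / (2 * γ) by positivity)
          have e : 1 / (2 * γ) * (γ ^ 2 * D) = γ / 2 * D := by field_simp
          have e' : 1 / (2 * γ) * (4 * E) = 2 / γ * E := by field_simp; ring
          rw [e, e'] at this
          exact this
        have h2 : 1 ≤ 1 / γ := by rw [le_div_iff₀ hγ]; linarith
        have e : 4 / γ * E - ((1 + 1 / (2 * γ)) * E + 2 / γ * E) = (3 / 2 * (1 / γ) - 1) * E := by
          field_simp; ring
        have : 0 ≤ (3 / 2 * (1 / γ) - 1) * E := mul_nonneg (by linarith) hE0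
        linarith

end Cheeger

/-! ### The collision form and rounding with quadratic loss -/

section Rounding

variable {X Y A B Ω : Type*} [Fintype Y] [Fintype B]

/-- The collision kernel of a game. -/
def collision (K : X → A → Y → B → ℝ) (x : X) (a : A) (x' : X) (a' : A) : ℝ :=
  ∑ y, ∑ b, K x a y b * K x' a' y b

variable {K : X → A → Y → B → ℝ} {e : X → Y → ℝ}

theorem collision_nonneg (hK : ∀ x a y b, 0 ≤ K x a y b) (x : X) (a : A) (x' : X) (a' : A) :
    0 ≤ collision K x a x' a' :=
  Finset.sum_nonneg fun _ _ => Finset.sum_nonneg fun _ _ => mul_nonneg (hK _ _ _ _) (hK _ _ _ _)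

/-- The hypothesis `hKe` is the projection property in kernel form; it is what bounds collisions by
the codegree, whatever the labels. -/
theorem collision_le (hK : ∀ x a y b, 0 ≤ K x a y b) (hKe : ∀ x a y, ∑ b, K x a y b ≤ e x y)
    (x : X) (a : A) (x' : X) (a' : A) : collision K x a x' a' ≤ ∑ y, e x y * e x' y := by
  refine Finset.sum_le_sum fun y _ => ?_
  have he : 0 ≤ e x' y := (Finset.sum_nonneg fun b _ => hK x' a' y b).trans (hKe x' a' y)
  calc ∑ b, K x a y b * K x' a' y b ≤ ∑ b, K x a y b * e x' y :=
        Finset.sum_le_sum fun b _ => mul_le_mul_of_nonneg_left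
          ((Finset.single_le_sum (fun b _ => hK x' a' y b) (Finset.mem_univ b)).trans (hKe x' a' y))
          (hK _ _ _ _)
    _ = (∑ b, K x a y b) * e x' y := by rw [Finset.sum_mul]
    _ ≤ _ := mul_le_mul_of_nonneg_right (hKe x a y) he

variable [Fintype A]

theorem sum_collision_le (hK : ∀ x a y b, 0 ≤ K x a y b)
    (hKe : ∀ x a y, ∑ b, K x a y b ≤ e x y) {F : X → A → ℝ} (hF : ∀ x a, 0 ≤ F x a) (x x' : X) :
    ∑ a, ∑ a', collision K x a x' a' * F x a * F x' a' ≤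
      (∑ y, e x y * e x' y) * ((∑ a, F x a) * ∑ a, F x' a) := by
  rw [Finset.sum_mul_sum, Finset.mul_sum]
  refine Finset.sum_le_sum fun a _ => ?_
  rw [Finset.mul_sum]
  refine Finset.sum_le_sum fun a' _ => ?_
  rw [mul_assoc]
  exact mul_le_mul_of_nonneg_right (collision_le hK hKe _ _ _ _) (mul_nonneg (hF _ _) (hF _ _))

theorem sum_collision_nonneg (hK : ∀ x a y b, 0 ≤ K x a y b) {F : X → A → ℝ}
    (hF : ∀ x a, 0 ≤ F x a) (x x' : X) :
    0 ≤ ∑ a, ∑ a', collision K x a x' a' * F x a * F x' a' :=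
  Finset.sum_nonneg fun _ _ => Finset.sum_nonneg fun _ _ =>
    mul_nonneg (mul_nonneg (collision_nonneg hK _ _ _ _) (hF _ _)) (hF _ _)

theorem sum_collision_div (F : X → A → ℝ) (g : X → ℝ) (x x' : X) :
    ∑ a, ∑ a', collision K x a x' a' * (F x a / g x) * (F x' a' / g x') =
      (∑ a, ∑ a', collision K x a x' a' * F x a * F x' a') / (g x * g x') := by
  rw [Finset.sum_div]
  refine Finset.sum_congr rfl fun a _ => ?_
  rw [Finset.sum_div]
  exact Finset.sum_congr rfl fun a' _ => by
    rw [mul_assoc, div_mul_div_comm, mul_div_assoc', mul_assoc]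

variable [Fintype X]

/-- The operator of a game with payoff kernel `K`, applied to a fractional labelling `F`. -/
def gameOp (K : X → A → Y → B → ℝ) (F : X → A → ℝ) (y : Y) (b : B) : ℝ :=
  ∑ x, ∑ a, K x a y b * F x a

theorem sum_gameOp_sq (K : X → A → Y → B → ℝ) (F : X → A → ℝ) :
    ∑ y, ∑ b, gameOp K F y b ^ 2 =
      ∑ x, ∑ x', ∑ a, ∑ a', collision K x a x' a' * F x a * F x' a' := by
  have h : ∀ y b, gameOp K F y b ^ 2 =
      ∑ x, ∑ x', ∑ a, ∑ a', K x a y b * K x' a' y b * F x a * F x' a' := by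
    intro y b
    rw [sq, gameOp, Finset.sum_mul_sum]
    refine Finset.sum_congr rfl fun x _ => Finset.sum_congr rfl fun x' _ => ?_
    rw [Finset.sum_mul_sum]
    exact Finset.sum_congr rfl fun a _ => Finset.sum_congr rfl fun a' _ => by ring
  simp only [h, collision, Finset.sum_mul]
  have h2 : ∀ f : Y → B → X → X → A → A → ℝ,
      ∑ y, ∑ b, ∑ x, ∑ x', ∑ a, ∑ a', f y b x x' a a' =
      ∑ x, ∑ x', ∑ a, ∑ a', ∑ y, ∑ b, f y b x x' a a' := by
    intro f
    simp only [← Fintype.sum_prod_type']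
    exact Fintype.sum_equiv
      ⟨fun z => (z.2.2.1, z.2.2.2.1, z.2.2.2.2.1, z.2.2.2.2.2, z.1, z.2.1),
        fun z => (z.2.2.2.2.1, z.2.2.2.2.2, z.1, z.2.1, z.2.2.1, z.2.2.2.1),
        fun _ => rfl, fun _ => rfl⟩ _ _ fun _ => rfl
  exact h2 _

theorem sum_sum_sum_mul (e : X → Y → ℝ) (f : X → ℝ) :
    ∑ x, ∑ x', (∑ y, e x y * e x' y) * (f x * f x') = ∑ y, (∑ x, e x y * f x) ^ 2 := by
  have h : ∀ y, (∑ x, e x y * f x) ^ 2 = ∑ x, ∑ x', e x y * e x' y * (f x * f x') := fun y => by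
    rw [sq, Finset.sum_mul_sum]
    exact Finset.sum_congr rfl fun x _ => Finset.sum_congr rfl fun x' _ => by ring
  simp only [h, Finset.sum_mul]
  symm
  rw [Finset.sum_comm]
  exact Finset.sum_congr rfl fun x _ => Finset.sum_comm

theorem sum_sum_codegree {d : ℝ} (hcol : ∀ y, ∑ x, e x y = d) :
    ∑ x, ∑ x', ∑ y, e x y * e x' y = Fintype.card Y * d ^ 2 := by
  have := sum_sum_sum_mul e (fun _ => 1)
  simpa [hcol] using this

variable [Fintype Ω]

/-- Rounding with quadratic loss: a vector labelling in the unit ball whose collision value is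
`ρ` yields a fractional labelling of collision value at least `ρ ^ 2 / 4`. -/
theorem exists_labelling_of_collision (hK : ∀ x a y b, 0 ≤ K x a y b)
    (hKe : ∀ x a y, ∑ b, K x a y b ≤ e x y) {d : ℝ} (hcol : ∀ y, ∑ x, e x y = d)
    (F : Ω → X → A → ℝ) (hF : ∀ ω x a, 0 ≤ F ω x a)
    (hF1 : ∀ x, ∑ ω, (∑ a, F ω x a) ^ 2 ≤ 1) :
    ∃ q : X → A → ℝ, (∀ x a, 0 ≤ q x a) ∧ (∀ x, ∑ a, q x a ≤ 1) ∧
      (∑ ω, ∑ y, ∑ b, gameOp K (F ω) y b ^ 2) ^ 2 ≤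
        4 * (Fintype.card Y * d ^ 2) * ∑ y, ∑ b, gameOp K q y b ^ 2 := by
  set g : Ω → X → ℝ := fun ω x => ∑ a, F ω x a with hg
  have hg0 : ∀ ω x, 0 ≤ g ω x := fun ω x => Finset.sum_nonneg fun a _ => hF ω x a
  set c : Ω → X → X → ℝ := fun ω x x' =>
    ∑ a, ∑ a', collision K x a x' a' * F ω x a * F ω x' a' with hc
  set m : X → X → ℝ := fun x x' => ∑ y, e x y * e x' y with hm
  have hc0 : ∀ ω x x', 0 ≤ c ω x x' := fun ω x x' => sum_collision_nonneg hK (hF ω) x x'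
  have hcm : ∀ ω x x', c ω x x' ≤ m x x' * (g ω x * g ω x') := fun ω x x' =>
    sum_collision_le hK hKe (hF ω) x x'
  have he : ∀ x a y, 0 ≤ e x y := fun x a y =>
    (Finset.sum_nonneg fun b _ => hK x a y b).trans (hKe x a y)
  have hm0 : ∀ (x x' : X) (_ : A), 0 ≤ m x x' := fun x x' a =>
    Finset.sum_nonneg fun y _ => mul_nonneg (he _ a _) (he _ a _)
  -- Cauchy-Schwarz gives `(∑ c) ^ 2 ≤ L * m * M` with `M ≤ 2`, hence the factor `4`. If `m = 0`,
  -- division by zero makes `R = 0`.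
  set R : X → X → ℝ := fun x x' => (∑ ω, c ω x x') ^ 2 / (4 * m x x') with hR
  rcases isEmpty_or_nonempty A with hA | ⟨⟨a₀⟩⟩
  · refine ⟨0, by simp, by simp, ?_⟩
    simp [gameOp]
  have hRm : ∀ x x', (∑ ω, max (g ω x ^ 2) (g ω x' ^ 2)) * R x x' ≤
      ∑ ω, min (g ω x ^ 2) (g ω x' ^ 2) * ∑ a, ∑ a', collision K x a x' a' *
        (F ω x a / g ω x) * (F ω x' a' / g ω x') := by
    intro x x'
    simp only [sum_collision_div]
    set L := ∑ ω, min (g ω x ^ 2) (g ω x' ^ 2) * (c ω x x' / (g ω x * g ω x')) with hL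
    set M := ∑ ω, max (g ω x ^ 2) (g ω x' ^ 2) with hM
    have hterm : ∀ ω, 0 ≤ min (g ω x ^ 2) (g ω x' ^ 2) * (c ω x x' / (g ω x * g ω x')) := fun ω =>
      mul_nonneg (le_min (sq_nonneg _) (sq_nonneg _))
        (div_nonneg (hc0 _ _ _) (mul_nonneg (hg0 _ _) (hg0 _ _)))
    have hL0 : 0 ≤ L := Finset.sum_nonneg fun ω _ => hterm ω
    have hM0 : 0 ≤ M := Finset.sum_nonneg fun ω _ => le_max_of_le_left (sq_nonneg _)
    have hM2 : M ≤ 2 := by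
      calc M ≤ ∑ ω, (g ω x ^ 2 + g ω x' ^ 2) := Finset.sum_le_sum fun ω _ =>
            max_le (by linarith [sq_nonneg (g ω x')]) (by linarith [sq_nonneg (g ω x)])
        _ ≤ 2 := by rw [Finset.sum_add_distrib]; linarith [hF1 x, hF1 x']
    rcases (hm0 x x' a₀).eq_or_lt with h0 | hpos
    · have : R x x' = 0 := by simp [R, ← h0]
      rw [this, mul_zero]; exact hL0
    have hCS : (∑ ω, c ω x x') ^ 2 ≤ L * (m x x' * M) := by
      rw [hM, Finset.mul_sum]
      refine Finset.sum_sq_le_sum_mul_sum_of_sq_le_mul _ (fun ω _ => hterm ω) (fun ω _ =>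
        mul_nonneg hpos.le (le_max_of_le_left (sq_nonneg _))) fun ω _ => ?_
      rcases (mul_nonneg (hg0 ω x) (hg0 ω x')).eq_or_lt with h1 | h1
      · have : c ω x x' = 0 := le_antisymm (by simpa [← h1] using hcm ω x x') (hc0 _ _ _)
        simp [this]
      · have e1 : min (g ω x ^ 2) (g ω x' ^ 2) * max (g ω x ^ 2) (g ω x' ^ 2) =
            (g ω x * g ω x') ^ 2 := by rw [min_mul_max]; ring
        calc c ω x x' ^ 2 ≤ c ω x x' * (m x x' * (g ω x * g ω x')) := by
              rw [sq]; exact mul_le_mul_of_nonneg_left (hcm _ _ _) (hc0 _ _ _)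
          _ = (min (g ω x ^ 2) (g ω x' ^ 2) * max (g ω x ^ 2) (g ω x' ^ 2)) *
              (c ω x x' / (g ω x * g ω x')) * m x x' := by
              rw [e1, sq (g ω x * g ω x'), mul_assoc (g ω x * g ω x'),
                mul_div_cancel₀ _ h1.ne']
              ring
          _ = _ := by ring
    simp only [R]
    rw [mul_div_assoc', div_le_iff₀ (by positivity)]
    have : M * (∑ ω, c ω x x') ^ 2 ≤ M * (L * (m x x' * M)) := mul_le_mul_of_nonneg_left hCS hM0
    have h4 : M * M ≤ 4 := by nlinarith
    have : M * M * (L * m x x') ≤ 4 * (L * m x x') :=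
      mul_le_mul_of_nonneg_right h4 (mul_nonneg hL0 hpos.le)
    nlinarith
  have hR0 : ∀ x x', (∀ ω, g ω x ^ 2 = 0) → R x x' = 0 := by
    intro x x' h0
    have : ∀ ω, c ω x x' = 0 := fun ω => by
      have hz : g ω x = 0 := by simpa using h0 ω
      exact le_antisymm (by simpa [hz] using hcm ω x x') (hc0 _ _ _)
    simp [R, this]
  have hR0' : ∀ x x', (∀ ω, g ω x' ^ 2 = 0) → R x x' = 0 := by
    intro x x' h0
    have : ∀ ω, c ω x x' = 0 := fun ω => by
      have hz : g ω x' = 0 := by simpa using h0 ω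
      exact le_antisymm (by simpa [hz] using hcm ω x x') (hc0 _ _ _)
    simp [R, this]
  obtain ⟨q, hq0, hq1, hq⟩ := exists_fractional_labelling (collision K) (collision_nonneg hK)
    (fun ω x a => F ω x a / g ω x) (fun ω x a => div_nonneg (hF _ _ _) (hg0 _ _))
    (fun ω x => by rw [← Finset.sum_div]; exact div_self_le_one _)
    (fun ω x => g ω x ^ 2) (fun ω x => sq_nonneg _) R hRm hR0 hR0'
  refine ⟨q, hq0, hq1, ?_⟩
  rw [sum_gameOp_sq K q]
  simp only [sum_gameOp_sq K]
  have h1 : ∑ ω, ∑ x, ∑ x', ∑ a, ∑ a', collision K x a x' a' * F ω x a * F ω x' a' =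
      ∑ z : X × X, ∑ ω, c ω z.1 z.2 := by
    rw [Finset.sum_comm, Fintype.sum_prod_type]
    exact Finset.sum_congr rfl fun x _ => Finset.sum_comm
  -- A second Cauchy-Schwarz, over pairs of vertices, turns the sum of the `R` into the square of
  -- the total collision value.
  have h2 : (∑ z : X × X, ∑ ω, c ω z.1 z.2) ^ 2 ≤
      (∑ z : X × X, 4 * m z.1 z.2) * ∑ z : X × X, R z.1 z.2 := by
    refine Finset.sum_sq_le_sum_mul_sum_of_sq_le_mul _ (fun z _ => ?_) (fun z _ => ?_)
      fun z _ => ?_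
    · linarith [hm0 z.1 z.2 a₀]
    · exact div_nonneg (sq_nonneg _) (by linarith [hm0 z.1 z.2 a₀])
    · rcases (hm0 z.1 z.2 a₀).eq_or_lt with h0 | h0
      · have : ∀ ω, c ω z.1 z.2 = 0 := fun ω =>
          le_antisymm (by simpa [← h0] using hcm ω z.1 z.2) (hc0 _ _ _)
        simp [this, R]
      · simp only [R]
        rw [mul_div_cancel₀ _ (by positivity)]
  rw [h1]
  refine h2.trans ?_
  rw [← Finset.mul_sum, Fintype.sum_prod_type, Fintype.sum_prod_type, sum_sum_codegree hcol]
  refine mul_le_mul_of_nonneg_left hq (by positivity)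

end Rounding

/-! ### Rounding with linear loss on small-set expanders -/

section LinearRounding

variable {X Y A B Ω : Type*}

/-- The weights of a bipartite graph, as a symmetric kernel on the disjoint union of its sides. -/
def bipartiteWeight (e : X → Y → ℝ) : X ⊕ Y → X ⊕ Y → ℝ
  | .inl x, .inr y => e x y
  | .inr y, .inl x => e x y
  | _, _ => 0

theorem bipartiteWeight_comm (e : X → Y → ℝ) (w w' : X ⊕ Y) :
    bipartiteWeight e w w' = bipartiteWeight e w' w := by
  cases w <;> cases w' <;> rfl

theorem bipartiteWeight_nonneg {e : X → Y → ℝ} (he : ∀ x y, 0 ≤ e x y) (w w' : X ⊕ Y) :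
    0 ≤ bipartiteWeight e w w' := by
  cases w <;> cases w' <;> simp [bipartiteWeight, he]

variable [Fintype X] [Fintype Y]

theorem sum_bipartiteWeight {e : X → Y → ℝ} {d : ℝ} (hrow : ∀ x, ∑ y, e x y = d)
    (hcol : ∀ y, ∑ x, e x y = d) (w : X ⊕ Y) : ∑ w', bipartiteWeight e w w' = d := by
  cases w <;> simp [bipartiteWeight, Fintype.sum_sum_type, hrow, hcol]

theorem sum_sum_bipartiteWeight_mul (e : X → Y → ℝ) (f : X ⊕ Y → X ⊕ Y → ℝ)
    (hf : ∀ w w', f w w' = f w' w) :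
    ∑ w, ∑ w', bipartiteWeight e w w' * f w w' =
      2 * ∑ x, ∑ y, e x y * f (.inl x) (.inr y) := by
  have h : ∑ y, ∑ x, e x y * f (.inr y) (.inl x) = ∑ x, ∑ y, e x y * f (.inl x) (.inr y) := by
    rw [Finset.sum_comm]
    exact Finset.sum_congr rfl fun x _ => Finset.sum_congr rfl fun y _ => by rw [hf]
  simp only [Fintype.sum_sum_type, bipartiteWeight, zero_mul, Finset.sum_const_zero, zero_add,
    add_zero, h]
  ring

variable [Fintype A] [Fintype B] [Fintype Ω] {K : X → A → Y → B → ℝ} {e : X → Y → ℝ}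

/-- Consistent selection of vertices on a small-set expander: from a vector labelling with
norms `g` one obtains selection weights that are comparable to `g ^ 2` and rarely separate
two neighbours of a vertex. -/
theorem exists_selection [DecidableEq X] [DecidableEq Y] (he : ∀ x y, 0 ≤ e x y) {d ε γ : ℝ}
    (hd : 0 < d) (hε : 0 < ε) (hε1 : ε ≤ 1) (hγ : 0 < γ) (hγ1 : γ ≤ 1)
    (hrow : ∀ x, ∑ y, e x y = d) (hcol : ∀ y, ∑ x, e x y = d)
    (hexp : ∀ S : Finset (X ⊕ Y), (S.card : ℝ) ≤ ε * Fintype.card (X ⊕ Y) →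
      γ * d * S.card ≤ cutWeight (bipartiteWeight e) S)
    (g : X → ℝ) (hg : ∀ x, 0 ≤ g x) :
    ∃ φ : X → ℝ, (∀ x, ε / 16 * g x ^ 2 ≤ φ x) ∧ (∀ x, φ x ≤ g x ^ 2 / 2) ∧
      ∑ x, ∑ x', (∑ y, e x y * e x' y) * |φ x - φ x'| ≤
        8 / γ * (d ^ 2 * ∑ x, g x ^ 2 - ∑ y, (∑ x, e x y * g x) ^ 2) := by
  -- Extending `g` to the other side by averages makes its energy on the bipartite graph equal to
  -- the drop in norm under averaging (`h4`). Two neighbours of `y` are then compared through `h y`.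
  set h : Y → ℝ := fun y => (∑ x, e x y * g x) / d with hh
  have hh0 : ∀ y, 0 ≤ h y := fun y =>
    div_nonneg (Finset.sum_nonneg fun x _ => mul_nonneg (he x y) (hg x)) hd.le
  obtain ⟨ψ, hlow, hup, hcut⟩ := exists_profile (bipartiteWeight e)
    (bipartiteWeight_nonneg he) (bipartiteWeight_comm e) hε hε1 hγ hγ1
    (sum_bipartiteWeight hrow hcol) hexp (Sum.elim g h)
  rw [sum_sum_bipartiteWeight_mul e (fun w w' => |ψ (Sum.elim g h w) - ψ (Sum.elim g h w')|)
    (fun w w' => abs_sub_comm _ _),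
    sum_sum_bipartiteWeight_mul e (fun w w' => (Sum.elim g h w - Sum.elim g h w') ^ 2)
    (fun w w' => by ring)] at hcut
  simp only [Sum.elim_inl, Sum.elim_inr] at hcut
  refine ⟨fun x => ψ (g x), fun x => hlow _ (hg x), fun x => hup _ (hg x), ?_⟩
  have h1 : ∑ x, ∑ x', (∑ y, e x y * e x' y) * |ψ (g x) - ψ (g x')| ≤
      ∑ x, ∑ x', ∑ y, (e x y * e x' y * |ψ (g x) - ψ (h y)| +
        e x y * e x' y * |ψ (g x') - ψ (h y)|) := by
    refine Finset.sum_le_sum fun x _ => Finset.sum_le_sum fun x' _ => ?_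
    rw [Finset.sum_mul]
    refine Finset.sum_le_sum fun y _ => ?_
    rw [← mul_add]
    refine mul_le_mul_of_nonneg_left ?_ (mul_nonneg (he _ _) (he _ _))
    rw [abs_sub_comm (ψ (g x'))]
    exact abs_sub_le _ _ _
  have h2 : ∑ x, ∑ x', ∑ y, e x y * e x' y * |ψ (g x) - ψ (h y)| =
      d * ∑ x, ∑ y, e x y * |ψ (g x) - ψ (h y)| := by
    rw [Finset.mul_sum]
    refine Finset.sum_congr rfl fun x _ => ?_
    rw [Finset.sum_comm, Finset.mul_sum]
    refine Finset.sum_congr rfl fun y _ => ?_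
    rw [← hcol y, Finset.sum_mul]
    exact Finset.sum_congr rfl fun x' _ => by ring
  have h3 : ∑ x, ∑ x', ∑ y, e x y * e x' y * |ψ (g x') - ψ (h y)| =
      d * ∑ x, ∑ y, e x y * |ψ (g x) - ψ (h y)| := by
    rw [← h2, Finset.sum_comm]
    exact Finset.sum_congr rfl fun x _ => Finset.sum_congr rfl fun x' _ =>
      Finset.sum_congr rfl fun y _ => by ring
  have h4 : d ^ 2 * ∑ x, g x ^ 2 - ∑ y, (∑ x, e x y * g x) ^ 2 =
      d * ∑ x, ∑ y, e x y * (g x - h y) ^ 2 := by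
    have a1 : ∑ x, ∑ y, e x y * g x ^ 2 = d * ∑ x, g x ^ 2 := by
      rw [Finset.mul_sum]
      exact Finset.sum_congr rfl fun x _ => by rw [← Finset.sum_mul, hrow]
    have a2 : ∑ x, ∑ y, e x y * (g x * h y) = d * ∑ y, h y ^ 2 := by
      rw [Finset.sum_comm, Finset.mul_sum]
      refine Finset.sum_congr rfl fun y _ => ?_
      have : ∑ x, e x y * g x = d * h y := by simp only [h]; field_simp
      calc ∑ x, e x y * (g x * h y) = (∑ x, e x y * g x) * h y := by
            rw [Finset.sum_mul]; exact Finset.sum_congr rfl fun x _ => by ring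
        _ = _ := by rw [this]; ring
    have a3 : ∑ x, ∑ y, e x y * h y ^ 2 = d * ∑ y, h y ^ 2 := by
      rw [Finset.sum_comm, Finset.mul_sum]
      exact Finset.sum_congr rfl fun y _ => by rw [← Finset.sum_mul, hcol]
    have a4 : ∑ x, ∑ y, e x y * (g x - h y) ^ 2 = ∑ x, ∑ y, e x y * g x ^ 2 -
        2 * ∑ x, ∑ y, e x y * (g x * h y) + ∑ x, ∑ y, e x y * h y ^ 2 := by
      simp only [Finset.mul_sum, ← Finset.sum_sub_distrib, ← Finset.sum_add_distrib]
      exact Finset.sum_congr rfl fun x _ => Finset.sum_congr rfl fun y _ => by ring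
    have a5 : ∑ y, (∑ x, e x y * g x) ^ 2 = d ^ 2 * ∑ y, h y ^ 2 := by
      rw [Finset.mul_sum]
      refine Finset.sum_congr rfl fun y _ => ?_
      simp only [h]; field_simp
    rw [a4, a1, a2, a3, a5]; ring
  simp only [Finset.sum_add_distrib] at h1
  rw [h2, h3] at h1
  rw [h4]
  have := mul_le_mul_of_nonneg_left hcut hd.le
  have e5 : 8 / γ * (d * ∑ x, ∑ y, e x y * (g x - h y) ^ 2) =
      d * (4 / γ * (2 * ∑ x, ∑ y, e x y * (g x - h y) ^ 2)) := by ring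
  rw [e5]
  linarith

theorem linear_loss_le {ε γ η a b c : ℝ} (hε : 0 < ε) (hε1 : ε ≤ 1) (hγ : 0 < γ) (hγ1 : γ ≤ 1)
    (hη : 0 ≤ η) (ha : a ≤ 2 * η) (hb : b ≤ 8 / γ * η) (hc : c ≤ η) :
    a + 32 / ε * (b + 1 / 2 * c) ≤ 300 / (ε * γ) * η := by
  have h1 : 1 ≤ 1 / γ := by rw [le_div_iff₀ hγ]; linarith
  have h2 : b + 1 / 2 * c ≤ 9 / γ * η := by
    have h3 : 9 / γ * η = 8 / γ * η + 1 / γ * η := by ring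
    have h4 : η ≤ 1 / γ * η := le_mul_of_one_le_left hη h1
    linarith
  have h3 := mul_le_mul_of_nonneg_left h2 (show 0 ≤ 32 / ε by positivity)
  have h4 : 1 ≤ 1 / (ε * γ) := by
    rw [le_div_iff₀ (by positivity), one_mul]
    exact mul_le_one₀ hε1 hγ.le hγ1
  have h5 : 300 / (ε * γ) * η - 32 / ε * (9 / γ * η) = 12 * (1 / (ε * γ) * η) := by
    field_simp; ring
  have h6 : η ≤ 1 / (ε * γ) * η := le_mul_of_one_le_left hη h4
  linarith

/-- Rounding with linear loss on a small-set expander: a vector labelling in the unit ball whose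
collision value is `1 - η` yields a fractional labelling of collision value
`1 - O(η / (ε γ))`. -/
theorem exists_labelling_of_expander [DecidableEq X] [DecidableEq Y]
    (hK : ∀ x a y b, 0 ≤ K x a y b)
    (hKe : ∀ x a y, ∑ b, K x a y b ≤ e x y) (he : ∀ x y, 0 ≤ e x y) {d ε γ : ℝ}
    (hd : 0 < d) (hε : 0 < ε) (hε1 : ε ≤ 1) (hγ : 0 < γ) (hγ1 : γ ≤ 1)
    (hrow : ∀ x, ∑ y, e x y = d) (hcol : ∀ y, ∑ x, e x y = d)
    (hexp : ∀ S : Finset (X ⊕ Y), (S.card : ℝ) ≤ ε * Fintype.card (X ⊕ Y) →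
      γ * d * S.card ≤ cutWeight (bipartiteWeight e) S)
    (F : Ω → X → A → ℝ) (hF : ∀ ω x a, 0 ≤ F ω x a)
    (hF1 : ∀ x, ∑ ω, (∑ a, F ω x a) ^ 2 ≤ 1) :
    ∃ q : X → A → ℝ, (∀ x a, 0 ≤ q x a) ∧ (∀ x, ∑ a, q x a ≤ 1) ∧
      Fintype.card X * d ^ 2 - 300 / (ε * γ) *
        (Fintype.card X * d ^ 2 - ∑ ω, ∑ y, ∑ b, gameOp K (F ω) y b ^ 2) ≤
        ∑ y, ∑ b, gameOp K q y b ^ 2 := by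
  set g : Ω → X → ℝ := fun ω x => ∑ a, F ω x a with hg
  have hg0 : ∀ ω x, 0 ≤ g ω x := fun ω x => Finset.sum_nonneg fun a _ => hF ω x a
  set c : Ω → X → X → ℝ := fun ω x x' =>
    ∑ a, ∑ a', collision K x a x' a' * F ω x a * F ω x' a' with hc
  set m : X → X → ℝ := fun x x' => ∑ y, e x y * e x' y with hm
  have hc0 : ∀ ω x x', 0 ≤ c ω x x' := fun ω x x' => sum_collision_nonneg hK (hF ω) x x'
  have hcm : ∀ ω x x', c ω x x' ≤ m x x' * (g ω x * g ω x') := fun ω x x' =>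
    sum_collision_le hK hKe (hF ω) x x'
  have hm0 : ∀ x x', 0 ≤ m x x' := fun x x' =>
    Finset.sum_nonneg fun y _ => mul_nonneg (he _ _) (he _ _)
  choose φ hφlow hφup hφcut using fun ω =>
    exists_selection he hd hε hε1 hγ hγ1 hrow hcol hexp (g ω) (hg0 ω)
  have hφ0 : ∀ ω x, 0 ≤ φ ω x := fun ω x => le_trans (by positivity) (hφlow ω x)
  set M : X → X → ℝ := fun x x' => ∑ ω, max (φ ω x) (φ ω x') with hM
  set s : X → X → ℝ := fun x x' =>
    ∑ ω, min (φ ω x) (φ ω x') * (c ω x x' / (g ω x * g ω x')) with hs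
  have hM0 : ∀ x x', 0 ≤ M x x' := fun x x' =>
    Finset.sum_nonneg fun ω _ => le_max_of_le_left (hφ0 _ _)
  have hs0 : ∀ x x', 0 ≤ s x x' := fun x x' => Finset.sum_nonneg fun ω _ =>
    mul_nonneg (le_min (hφ0 _ _) (hφ0 _ _))
      (div_nonneg (hc0 _ _ _) (mul_nonneg (hg0 _ _) (hg0 _ _)))
  set D : X → ℝ := fun x => ∑ ω, g ω x ^ 2 with hD
  have hD1 : ∀ x, D x ≤ 1 := hF1
  obtain ⟨q, hq0, hq1, hq⟩ := exists_fractional_labelling (collision K) (collision_nonneg hK)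
    (fun ω x a => F ω x a / g ω x) (fun ω x a => div_nonneg (hF _ _ _) (hg0 _ _))
    (fun ω x => by rw [← Finset.sum_div]; exact div_self_le_one _)
    φ hφ0 (fun x x' => s x x' / M x x')
    (fun x x' => by
      simp only [sum_collision_div]
      change M x x' * (s x x' / M x x') ≤ s x x'
      rcases (hM0 x x').eq_or_lt with h | h
      · rw [← h, zero_mul]; exact hs0 x x'
      · rw [mul_div_cancel₀ _ h.ne'])
    (fun x x' h => by
      have : s x x' = 0 := Finset.sum_eq_zero fun ω _ => by
        rw [h ω, min_eq_left (hφ0 _ _), zero_mul]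
      simp [this])
    (fun x x' h => by
      have : s x x' = 0 := Finset.sum_eq_zero fun ω _ => by
        rw [h ω, min_eq_right (hφ0 _ _), zero_mul]
      simp [this])
  refine ⟨q, hq0, hq1, ?_⟩
  rw [sum_gameOp_sq K q]
  refine le_trans ?_ hq
  -- The two losses at a pair: selecting only one of the vertices, and disagreeing when both are
  -- selected.
  set Z : X → X → ℝ := fun x x' => ∑ ω, m x x' * |φ ω x - φ ω x'| +
    1 / 2 * ∑ ω, (m x x' * (g ω x * g ω x') - c ω x x') with hZ
  have hZ0 : ∀ x x', 0 ≤ Z x x' := fun x x' =>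
    add_nonneg (Finset.sum_nonneg fun ω _ => mul_nonneg (hm0 _ _) (abs_nonneg _))
      (mul_nonneg (by norm_num) (Finset.sum_nonneg fun ω _ => sub_nonneg.2 (hcm _ _ _)))
  have hZs : ∀ x x', m x x' * M x x' - s x x' ≤ Z x x' := by
    intro x x'
    simp only [M, s, Z, Finset.mul_sum, ← Finset.sum_sub_distrib, ← Finset.sum_add_distrib]
    refine Finset.sum_le_sum fun ω _ => ?_
    have habs : max (φ ω x) (φ ω x') = min (φ ω x) (φ ω x') + |φ ω x - φ ω x'| := by
      rw [← max_sub_min_eq_abs']; ring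
    rw [habs]
    set μ := min (φ ω x) (φ ω x') with hμ
    have hμ0 : 0 ≤ μ := le_min (hφ0 _ _) (hφ0 _ _)
    have hμle : μ ≤ g ω x * g ω x' / 2 := by
      rcases le_total (g ω x) (g ω x') with h | h
      · refine (min_le_left _ _).trans ((hφup ω x).trans ?_)
        nlinarith [hg0 ω x]
      · refine (min_le_right _ _).trans ((hφup ω x').trans ?_)
        nlinarith [hg0 ω x']
    have key : μ * m x x' - μ * (c ω x x' / (g ω x * g ω x')) ≤
        1 / 2 * (m x x' * (g ω x * g ω x') - c ω x x') := by
      rcases (mul_nonneg (hg0 ω x) (hg0 ω x')).eq_or_lt with h | h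
      · have hμz : μ = 0 := le_antisymm (by rw [← h] at hμle; linarith) hμ0
        have := sub_nonneg.2 (hcm ω x x')
        rw [hμz]; linarith
      · have e1 : μ * m x x' - μ * (c ω x x' / (g ω x * g ω x')) =
            μ / (g ω x * g ω x') * (m x x' * (g ω x * g ω x') - c ω x x') := by
          have hgen : ∀ r P : ℝ, P ≠ 0 → μ * r - μ * (c ω x x' / P) =
              μ / P * (r * P - c ω x x') := fun r P hP => by field_simp
          exact hgen _ _ h.ne'
        rw [e1]
        refine mul_le_mul_of_nonneg_right ?_ (sub_nonneg.2 (hcm _ _ _))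
        rw [div_le_iff₀ h]; linarith
    linarith
  -- If `D x ≤ 1 / 2`, the pair is given up and charged to the missing norm `1 - D x`. Otherwise the
  -- total selection weight is at least `ε / 32`, so dividing by it is affordable.
  have hpt : ∀ x x', m x x' - s x x' / M x x' ≤
      2 * ((1 - D x) * m x x') + 32 / ε * Z x x' := by
    intro x x'
    have hR0 : 0 ≤ s x x' / M x x' := div_nonneg (hs0 _ _) (hM0 _ _)
    have hZ' : 0 ≤ 32 / ε * Z x x' := mul_nonneg (by positivity) (hZ0 x x')
    rcases le_total (D x) (1 / 2) with h | h
    · nlinarith [hm0 x x']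
    · have hMlow : ε / 32 ≤ M x x' := by
        calc ε / 32 ≤ ε / 16 * D x := by nlinarith
          _ = ∑ ω, ε / 16 * g ω x ^ 2 := by rw [Finset.mul_sum]
          _ ≤ M x x' := Finset.sum_le_sum fun ω _ => (hφlow ω x).trans (le_max_left _ _)
      have hMpos : 0 < M x x' := lt_of_lt_of_le (by positivity) hMlow
      have h1 : m x x' - s x x' / M x x' ≤ 32 / ε * Z x x' := by
        have e1 : m x x' - s x x' / M x x' = (m x x' * M x x' - s x x') / M x x' := by
          field_simp
        rw [e1, div_le_iff₀ hMpos]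
        refine (hZs x x').trans ?_
        have h2 : 1 ≤ 32 / ε * M x x' := by
          rw [div_mul_eq_mul_div, le_div_iff₀ hε]; linarith
        nlinarith [hZ0 x x']
      have := mul_nonneg (sub_nonneg.2 (hD1 x)) (hm0 x x')
      linarith
  set N : ℝ := ((Fintype.card X : ℕ) : ℝ) with hN
  set Q : ℝ := ∑ ω, ∑ y, ∑ b, gameOp K (F ω) y b ^ 2 with hQ
  set H : ℝ := ∑ ω, ∑ y, (∑ x, e x y * g ω x) ^ 2 with hH
  have hQc : ∑ ω, ∑ x, ∑ x', c ω x x' = Q :=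
    Finset.sum_congr rfl fun ω _ => (sum_gameOp_sq K (F ω)).symm
  have hHm : ∑ ω, ∑ x, ∑ x', m x x' * (g ω x * g ω x') = H :=
    Finset.sum_congr rfl fun ω _ => sum_sum_sum_mul e (g ω)
  have hQH : Q ≤ H := by
    rw [← hQc, ← hHm]
    exact Finset.sum_le_sum fun ω _ => Finset.sum_le_sum fun x _ =>
      Finset.sum_le_sum fun x' _ => hcm ω x x'
  have hrot : ∀ f : X → X → Ω → ℝ, ∑ x, ∑ x', ∑ ω, f x x' ω = ∑ ω, ∑ x, ∑ x', f x x' ω := fun f =>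
    (Finset.sum_congr rfl fun x _ => Finset.sum_comm).trans Finset.sum_comm
  have hDg : ∑ ω, ∑ x, g ω x ^ 2 = ∑ x, D x := Finset.sum_comm
  have hcutsum : ∑ x, ∑ x', ∑ ω, m x x' * |φ ω x - φ ω x'| ≤ 8 / γ * (d ^ 2 * ∑ x, D x - H) := by
    rw [hrot, ← hDg, hH, Finset.mul_sum, ← Finset.sum_sub_distrib, Finset.mul_sum]
    exact Finset.sum_le_sum fun ω _ => hφcut ω
  have hsumD : ∑ x, D x ≤ N := by
    calc ∑ x, D x ≤ ∑ _x : X, (1:ℝ) := Finset.sum_le_sum fun x _ => hD1 x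
      _ = N := by simp [N]
  have hHD : H ≤ d ^ 2 * ∑ x, D x := by
    have h0 : 0 ≤ ∑ x, ∑ x', ∑ ω, m x x' * |φ ω x - φ ω x'| :=
      Finset.sum_nonneg fun x _ => Finset.sum_nonneg fun x' _ => Finset.sum_nonneg fun ω _ =>
        mul_nonneg (hm0 _ _) (abs_nonneg _)
    by_contra hcon
    push Not at hcon
    have : 8 / γ * (d ^ 2 * ∑ x, D x - H) < 0 :=
      mul_neg_of_pos_of_neg (by positivity) (by linarith)
    linarith
  have hrowm : ∀ x, ∑ x', m x x' = d ^ 2 := fun x => by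
    simp only [m]
    rw [Finset.sum_comm]
    simp only [← Finset.mul_sum, hcol, ← Finset.sum_mul, hrow]
    ring
  have hbad : ∑ x, ∑ x', 2 * ((1 - D x) * m x x') = 2 * (d ^ 2 * (N - ∑ x, D x)) := by
    have : ∑ x, (1 - D x) = N - ∑ x, D x := by simp [N]
    rw [← this, Finset.mul_sum, Finset.mul_sum]
    refine Finset.sum_congr rfl fun x _ => ?_
    rw [← Finset.mul_sum, ← Finset.mul_sum, hrowm]
    ring
  have hgap : ∑ x, ∑ x', ∑ ω, (m x x' * (g ω x * g ω x') - c ω x x') = H - Q := by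
    rw [hrot, ← hHm, ← hQc]
    simp only [Finset.sum_sub_distrib]
  have hsumm : ∑ x, ∑ x', m x x' = N * d ^ 2 := by
    simp [hrowm, N]
  have htot := Finset.sum_le_sum fun x (_ : x ∈ Finset.univ) =>
    Finset.sum_le_sum fun x' (_ : x' ∈ Finset.univ) => hpt x x'
  have hZsum : ∑ x, ∑ x', Z x x' =
      ∑ x, ∑ x', ∑ ω, m x x' * |φ ω x - φ ω x'| + 1 / 2 * (H - Q) := by
    rw [← hgap]
    simp only [Z, Finset.sum_add_distrib, Finset.mul_sum]
  simp only [Finset.sum_sub_distrib, Finset.sum_add_distrib] at htot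
  rw [hbad, hsumm] at htot
  have hZ32 : ∑ x, ∑ x', 32 / ε * Z x x' = 32 / ε * ∑ x, ∑ x', Z x x' := by
    simp only [Finset.mul_sum]
  rw [hZ32, hZsum] at htot
  -- `η` is the sum of three nonnegative deficits: missing norm `d ^ 2 * (N - ∑ D)`, energy `d ^ 2 *
  -- ∑ D - H`, and failed collisions `H - Q`. Each loss is linear in one of them.
  set η := N * d ^ 2 - Q with hη
  have hDN : d ^ 2 * ∑ x, D x ≤ d ^ 2 * N := mul_le_mul_of_nonneg_left hsumD (by positivity)
  have hη0 : 0 ≤ η := by linarith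
  have hloss := linear_loss_le hε hε1 hγ hγ1 hη0
    (show 2 * (d ^ 2 * (N - ∑ x, D x)) ≤ 2 * η by rw [mul_sub]; linarith)
    (hcutsum.trans (mul_le_mul_of_nonneg_left (by linarith) (by positivity)))
    (show H - Q ≤ η by linarith)
  linarith

end LinearRounding

/-! ### Multiplicativity under repetition -/

section Tensor

variable {X Y A B : Type*}

/-- The payoff kernel of the `t`-fold repetition. -/
def tensorKernel (K : X → A → Y → B → ℝ) (t : ℕ) (x : Fin t → X) (a : Fin t → A)
    (y : Fin t → Y) (b : Fin t → B) : ℝ :=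
  ∏ i, K (x i) (a i) (y i) (b i)

theorem tensorKernel_nonneg {K : X → A → Y → B → ℝ} (hK : ∀ x a y b, 0 ≤ K x a y b) (t : ℕ)
    (x : Fin t → X) (a : Fin t → A) (y : Fin t → Y) (b : Fin t → B) :
    0 ≤ tensorKernel K t x a y b :=
  Finset.prod_nonneg fun _ _ => hK _ _ _ _

variable [Fintype X]

theorem sum_fin_cons {t : ℕ} (f : (Fin (t + 1) → X) → ℝ) :
    ∑ x, f x = ∑ x₀, ∑ x : Fin t → X, f (Fin.cons x₀ x) := by
  rw [← Equiv.sum_comp (Fin.consEquiv fun _ => X), Fintype.sum_prod_type]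
  rfl

variable [Fintype A]

theorem gameOp_smul (K : X → A → Y → B → ℝ) (c : ℝ) (F : X → A → ℝ) (y : Y) (b : B) :
    gameOp K (fun x a => c * F x a) y b = c * gameOp K F y b := by
  simp only [gameOp, Finset.mul_sum]
  exact Finset.sum_congr rfl fun x _ => Finset.sum_congr rfl fun a _ => by ring

theorem gameOp_sum {ι : Type*} (s : Finset ι) (K : X → A → Y → B → ℝ) (F : ι → X → A → ℝ) (y : Y)
    (b : B) : gameOp K (fun x a => ∑ i ∈ s, F i x a) y b = ∑ i ∈ s, gameOp K (F i) y b := by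
  simp only [gameOp, Finset.mul_sum]
  symm
  rw [Finset.sum_comm]
  exact Finset.sum_congr rfl fun x _ => Finset.sum_comm

theorem gameOp_nonneg {K : X → A → Y → B → ℝ} (hK : ∀ x a y b, 0 ≤ K x a y b) {F : X → A → ℝ}
    (hF : ∀ x a, 0 ≤ F x a) (y : Y) (b : B) : 0 ≤ gameOp K F y b :=
  Finset.sum_nonneg fun _ _ => Finset.sum_nonneg fun _ _ => mul_nonneg (hK _ _ _ _) (hF _ _)

theorem gameOp_tensorKernel_succ (K : X → A → Y → B → ℝ) {t : ℕ}
    (F : (Fin (t + 1) → X) → (Fin (t + 1) → A) → ℝ) (y₀ : Y) (y : Fin t → Y) (b₀ : B)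
    (b : Fin t → B) :
    gameOp (tensorKernel K (t + 1)) F (Fin.cons y₀ y) (Fin.cons b₀ b) =
      gameOp K (fun x₀ a₀ => gameOp (tensorKernel K t)
        (fun x a => F (Fin.cons x₀ x) (Fin.cons a₀ a)) y b) y₀ b₀ := by
  simp only [gameOp, sum_fin_cons, tensorKernel, Fin.prod_univ_succ, Fin.cons_zero, Fin.cons_succ,
    Finset.mul_sum]
  refine Finset.sum_congr rfl fun x₀ _ => ?_
  rw [Finset.sum_comm]
  exact Finset.sum_congr rfl fun a₀ _ => Finset.sum_congr rfl fun x _ =>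
    Finset.sum_congr rfl fun a _ => mul_assoc _ _ _

variable [Fintype Y] [Fintype B]

/-- Multiplicativity: a bound on the collision value of vector labellings of a game bounds the
collision value of labellings of its repetitions. -/
theorem sum_gameOp_tensorKernel_sq_le {K : X → A → Y → B → ℝ} (hK : ∀ x a y b, 0 ≤ K x a y b)
    {κ : ℝ} (hκ0 : 0 < κ)
    (hκ : ∀ (t : ℕ) (F : (Fin t → Y) × (Fin t → B) → X → A → ℝ), (∀ ω x a, 0 ≤ F ω x a) →
      (∀ x, ∑ ω, (∑ a, F ω x a) ^ 2 ≤ 1) → ∑ ω, ∑ y, ∑ b, gameOp K (F ω) y b ^ 2 ≤ κ) (t : ℕ)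
    (F : (Fin t → X) → (Fin t → A) → ℝ) (hF : ∀ x a, 0 ≤ F x a) (hF1 : ∀ x, ∑ a, F x a ≤ 1) :
    ∑ y, ∑ b, gameOp (tensorKernel K t) F y b ^ 2 ≤ κ ^ t := by
  induction t with
  | zero =>
    have h := hF1 default
    simp only [Fintype.sum_unique] at h
    simp only [gameOp, tensorKernel, Fintype.sum_unique, Finset.univ_eq_empty, Finset.prod_empty,
      one_mul, pow_zero]
    exact pow_le_one₀ (hF _ _) h
  | succ t ih =>
    let F' : (Fin t → Y) × (Fin t → B) → X → A → ℝ := fun ω x₀ a₀ =>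
      gameOp (tensorKernel K t) (fun x a => F (Fin.cons x₀ x) (Fin.cons a₀ a)) ω.1 ω.2
    have hF' : ∀ ω x a, 0 ≤ F' ω x a := fun ω x a =>
      gameOp_nonneg (tensorKernel_nonneg hK t) (fun _ _ => hF _ _) _ _
    -- Summing over `a₀` commutes with the operator and leaves a fractional labelling of the
    -- `t`-fold game, so induction bounds the norm. Rescaling by `√(κ ^ t)` then gives a vector
    -- labelling in the unit ball.
    have hnorm : ∀ x₀, ∑ ω, (∑ a₀, F' ω x₀ a₀) ^ 2 ≤ κ ^ t := fun x₀ => by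
      simp only [F', ← gameOp_sum]
      rw [Fintype.sum_prod_type]
      refine ih _ (fun x a => Finset.sum_nonneg fun _ _ => hF _ _) fun x => ?_
      rw [Finset.sum_comm, ← sum_fin_cons]
      exact hF1 _
    have hpos : 0 < κ ^ t := pow_pos hκ0 t
    have hsq : (√(κ ^ t))⁻¹ ^ 2 = (κ ^ t)⁻¹ := by rw [inv_pow, Real.sq_sqrt hpos.le]
    have key := hκ t (fun ω x a => (√(κ ^ t))⁻¹ * F' ω x a)
      (fun ω x a => mul_nonneg (by positivity) (hF' ω x a)) fun x => by
        simp only [← Finset.mul_sum, mul_pow, hsq]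
        rw [inv_mul_le_iff₀ hpos, mul_one]
        exact hnorm x
    simp only [gameOp_smul, mul_pow, hsq, ← Finset.mul_sum] at key
    rw [inv_mul_le_iff₀ hpos] at key
    have e1 : ∑ y, ∑ b, gameOp (tensorKernel K (t + 1)) F y b ^ 2 =
        ∑ ω, ∑ y, ∑ b, gameOp K (F' ω) y b ^ 2 := by
      simp only [sum_fin_cons, gameOp_tensorKernel_succ, F', Fintype.sum_prod_type]
      rw [Finset.sum_comm]
      refine Finset.sum_congr rfl fun y _ => ?_
      have : ∀ y₀ : Y, ∑ b₀, ∑ b : Fin t → B, gameOp K (fun x₀ a₀ => gameOp (tensorKernel K t)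
          (fun x a => F (Fin.cons x₀ x) (Fin.cons a₀ a)) y b) y₀ b₀ ^ 2 =
          ∑ b : Fin t → B, ∑ b₀, gameOp K (fun x₀ a₀ => gameOp (tensorKernel K t)
          (fun x a => F (Fin.cons x₀ x) (Fin.cons a₀ a)) y b) y₀ b₀ ^ 2 :=
        fun y₀ => Finset.sum_comm
      simp only [this]
      exact Finset.sum_comm
    rw [e1, pow_succ]
    exact key

end Tensor

/-! ### Game value versus collision value -/

namespace TwoPlayerGame

open Classical in
/-- The indicator of the set of question pairs. -/
noncomputable def edgeWeight {X Y A B : Type*} (Ψ : TwoPlayerGame X Y A B) (x : X) (y : Y) : ℝ :=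
  if (x, y) ∈ Ψ.edges then 1 else 0

open Classical in
/-- The payoff kernel of a game: `1` on the accepted answers to question pairs. -/
noncomputable def payoff {X Y A B : Type*} (Ψ : TwoPlayerGame X Y A B) (x : X) (a : A) (y : Y) (b : B) : ℝ :=
  if (x, y) ∈ Ψ.edges ∧ Ψ.accept x y a b then 1 else 0

section Basic

variable {X Y A B : Type*} (Ψ : TwoPlayerGame X Y A B)

theorem edgeWeight_nonneg (x : X) (y : Y) : 0 ≤ Ψ.edgeWeight x y := by
  unfold edgeWeight; split_ifs <;> norm_num

theorem payoff_nonneg (x : X) (a : A) (y : Y) (b : B) : 0 ≤ Ψ.payoff x a y b := by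
  unfold payoff; split_ifs <;> norm_num

theorem sum_payoff_le [Fintype B] {Ψ : TwoPlayerGame X Y A B} (hΨ : Ψ.IsProjection) (x : X) (a : A)
    (y : Y) : ∑ b, Ψ.payoff x a y b ≤ Ψ.edgeWeight x y := by
  classical
  by_cases h : (x, y) ∈ Ψ.edges
  · obtain ⟨π, hπ⟩ := hΨ x y h
    simp only [payoff, edgeWeight, h, true_and, if_true, hπ, Finset.sum_boole]
    have : (Finset.univ.filter fun b => π a = some b).card ≤ 1 := by
      refine Finset.card_le_one.2 fun b hb b' hb' => ?_
      simp only [Finset.mem_filter, Finset.mem_univ, true_and] at hb hb'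
      exact Option.some_injective _ (hb.symm.trans hb')
    exact_mod_cast this
  · simp [payoff, edgeWeight, h]

theorem winProb_le_one [Finite X] [Finite Y] (f : X → A) (g : Y → B) : Ψ.winProb f g ≤ 1 := by
  refine div_le_one_of_le₀ ?_ (Nat.cast_nonneg _)
  exact_mod_cast Set.ncard_le_ncard (Set.sep_subset _ _) (Set.toFinite _)

theorem value_nonneg : 0 ≤ Ψ.value :=
  Real.iSup_nonneg fun _ => div_nonneg (Nat.cast_nonneg _) (Nat.cast_nonneg _)

theorem winProb_le_value [Finite X] [Finite Y] (f : X → A) (g : Y → B) :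
    Ψ.winProb f g ≤ Ψ.value := by
  refine le_ciSup (f := fun s : (X → A) × (Y → B) => Ψ.winProb s.1 s.2) ⟨1, ?_⟩ (f, g)
  rintro _ ⟨s, rfl⟩
  exact Ψ.winProb_le_one _ _

/-- With no question pairs the winning probability is `0 / 0 = 0`, except that the `0`-fold
repetition still has the empty question pair; `0 ^ t` covers both cases. -/
theorem value_repetition_of_edges_eq_empty [Finite X] [Finite Y] (hΨ : Ψ.edges = ∅) (t : ℕ) :
    (Ψ.repetition t).value ≤ 0 ^ t := by
  refine Real.iSup_le (fun s => ?_) (by positivity)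
  rcases t with _ | t
  · simpa using winProb_le_one _ _ _
  · have : (Ψ.repetition (t + 1)).edges = ∅ := by
      ext q; simp [repetition, hΨ]
    simp [winProb, this]

theorem payoff_repetition (t : ℕ) (x : Fin t → X) (a : Fin t → A) (y : Fin t → Y) (b : Fin t → B) :
    (Ψ.repetition t).payoff x a y b = tensorKernel Ψ.payoff t x a y b := by
  classical
  simp only [payoff, tensorKernel, repetition, Set.mem_ofPred_eq, ← forall_and, Finset.prod_boole,
    Finset.mem_univ, true_imp_iff]

variable [Fintype X] [Fintype Y]

theorem ncard_edges : (Ψ.edges.ncard : ℝ) = ∑ x, ∑ y, Ψ.edgeWeight x y := by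
  classical
  rw [← Fintype.sum_prod_type']
  simp only [edgeWeight, Prod.mk.eta, Finset.sum_boole]
  rw [Set.ncard_eq_toFinset_card', Set.toFinset]
  congr 2
  ext; simp

theorem winProb_eq (f : X → A) (g : Y → B) :
    Ψ.winProb f g = (∑ x, ∑ y, Ψ.payoff x (f x) y (g y)) / ∑ x, ∑ y, Ψ.edgeWeight x y := by
  classical
  rw [winProb, ncard_edges]
  congr 1
  rw [← Fintype.sum_prod_type' (f := fun x y => Ψ.payoff x (f x) y (g y))]
  simp only [payoff, Prod.mk.eta, Finset.sum_boole]
  rw [Set.ncard_eq_toFinset_card']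
  congr 2
  ext; simp

theorem sum_edgeWeight_repetition (t : ℕ) :
    ∑ x, ∑ y, (Ψ.repetition t).edgeWeight x y = (∑ x, ∑ y, Ψ.edgeWeight x y) ^ t := by
  classical
  have h : ∀ x y, (Ψ.repetition t).edgeWeight x y = ∏ i, Ψ.edgeWeight (x i) (y i) := fun x y => by
    simp only [edgeWeight, repetition, Set.mem_ofPred_eq, Finset.prod_boole, Finset.mem_univ,
      true_imp_iff]
    congr
  simp only [h]
  rw [← Fintype.sum_prod_type' (f := fun x y => Ψ.edgeWeight x y), ← Fin.prod_const,
    ← Fintype.sum_prod_type' (f := fun (x : Fin t → X) (y : Fin t → Y) =>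
      ∏ i, Ψ.edgeWeight (x i) (y i)),
    Finset.prod_univ_sum, Fintype.piFinset_univ]
  exact Fintype.sum_equiv (Equiv.arrowProdEquivProdArrow (Fin t) (fun _ => X) (fun _ => Y)).symm
    _ _ fun _ => rfl

end Basic

section Value

variable {X Y A B : Type*} [Fintype X] [Fintype Y] [Fintype A] [Fintype B]
  {Ψ : TwoPlayerGame X Y A B}

/-- A fractional labelling of large collision value gives a strategy that wins often. -/
theorem sum_gameOp_sq_le_value (hΨ : Ψ.IsProjection) {d : ℝ} (hd : 0 ≤ d)
    (hcol : ∀ y, ∑ x, Ψ.edgeWeight x y = d) (hE : 0 < ∑ x, ∑ y, Ψ.edgeWeight x y)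
    {q : X → A → ℝ} (hq : ∀ x a, 0 ≤ q x a) (hq1 : ∀ x, ∑ a, q x a ≤ 1) :
    ∑ y, ∑ b, gameOp Ψ.payoff q y b ^ 2 ≤ d * (Ψ.value * ∑ x, ∑ y, Ψ.edgeWeight x y) := by
  have hval := Ψ.value_nonneg
  rcases isEmpty_or_nonempty A with hA | hA
  · simp only [gameOp, Finset.univ_eq_empty, Finset.sum_empty, Finset.sum_const_zero, ne_eq,
      OfNat.ofNat_ne_zero, not_false_eq_true, zero_pow]
    positivity
  rcases isEmpty_or_nonempty B with hB | hB
  · simp only [Finset.univ_eq_empty, Finset.sum_empty, Finset.sum_const_zero]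
    positivity
  have hop0 : ∀ y b, 0 ≤ gameOp Ψ.payoff q y b := fun y b => gameOp_nonneg Ψ.payoff_nonneg hq y b
  -- Bob answers with the `b` of largest mass at `y`; as the masses sum to at most `d`, the sum of
  -- squares is at most `d` times the largest. Alice then best-responds to `g`.
  choose g hg using fun y => Finite.exists_max fun b => gameOp Ψ.payoff q y b
  have hsum : ∀ y, ∑ b, gameOp Ψ.payoff q y b ≤ d := fun y => by
    simp only [gameOp]
    rw [Finset.sum_comm, ← hcol y]
    refine Finset.sum_le_sum fun x _ => ?_
    rw [Finset.sum_comm]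
    calc ∑ a, ∑ b, Ψ.payoff x a y b * q x a ≤ ∑ a, Ψ.edgeWeight x y * q x a :=
          Finset.sum_le_sum fun a _ => by
            rw [← Finset.sum_mul]
            exact mul_le_mul_of_nonneg_right (sum_payoff_le hΨ x a y) (hq _ _)
      _ = Ψ.edgeWeight x y * ∑ a, q x a := by rw [Finset.mul_sum]
      _ ≤ Ψ.edgeWeight x y := mul_le_of_le_one_right (Ψ.edgeWeight_nonneg _ _) (hq1 x)
  have h1 : ∑ y, ∑ b, gameOp Ψ.payoff q y b ^ 2 ≤ d * ∑ y, gameOp Ψ.payoff q y (g y) := by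
    rw [Finset.mul_sum]
    refine Finset.sum_le_sum fun y _ => ?_
    calc ∑ b, gameOp Ψ.payoff q y b ^ 2 ≤
          ∑ b, gameOp Ψ.payoff q y b * gameOp Ψ.payoff q y (g y) :=
          Finset.sum_le_sum fun b _ => by
            rw [sq]; exact mul_le_mul_of_nonneg_left (hg y b) (hop0 y b)
      _ = (∑ b, gameOp Ψ.payoff q y b) * gameOp Ψ.payoff q y (g y) := by rw [Finset.sum_mul]
      _ ≤ _ := mul_le_mul_of_nonneg_right (hsum y) (hop0 _ _)
  refine h1.trans (mul_le_mul_of_nonneg_left ?_ hd)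
  choose f hf using fun x => Finite.exists_max fun a => ∑ y, Ψ.payoff x a y (g y)
  have h2 : ∑ y, gameOp Ψ.payoff q y (g y) ≤ ∑ x, ∑ y, Ψ.payoff x (f x) y (g y) := by
    simp only [gameOp]
    rw [Finset.sum_comm]
    refine Finset.sum_le_sum fun x _ => ?_
    rw [Finset.sum_comm]
    calc ∑ a, ∑ y, Ψ.payoff x a y (g y) * q x a
        ≤ ∑ a, (∑ y, Ψ.payoff x (f x) y (g y)) * q x a := Finset.sum_le_sum fun a _ => by
          rw [← Finset.sum_mul]
          exact mul_le_mul_of_nonneg_right (hf x a) (hq _ _)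
      _ = (∑ y, Ψ.payoff x (f x) y (g y)) * ∑ a, q x a := by rw [Finset.mul_sum]
      _ ≤ _ := mul_le_of_le_one_right (Finset.sum_nonneg fun y _ => Ψ.payoff_nonneg _ _ _ _)
          (hq1 x)
  refine h2.trans ?_
  have h3 := Ψ.winProb_le_value f g
  rwa [winProb_eq, div_le_iff₀ hE] at h3

/-- A bound on the collision value of the repeated game bounds its value. -/
theorem value_repetition_le {d r : ℝ} (hr : 0 ≤ r)
    (hE : 0 < ∑ x, ∑ y, Ψ.edgeWeight x y)
    (hEd : ∑ x, ∑ y, Ψ.edgeWeight x y = Fintype.card Y * d) (t : ℕ)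
    (h : ∀ F : (Fin t → X) → (Fin t → A) → ℝ, (∀ x a, 0 ≤ F x a) → (∀ x, ∑ a, F x a ≤ 1) →
      ∑ y, ∑ b, gameOp (tensorKernel Ψ.payoff t) F y b ^ 2 ≤
        (r ^ 2 * (Fintype.card Y * d ^ 2)) ^ t) :
    (Ψ.repetition t).value ≤ r ^ t := by
  classical
  refine Real.iSup_le ?_ (pow_nonneg hr t)
  rintro ⟨f, g⟩
  dsimp only
  rw [winProb_eq, sum_edgeWeight_repetition, div_le_iff₀ (pow_pos hE t), ← mul_pow]
  simp only [payoff_repetition]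
  let F : (Fin t → X) → (Fin t → A) → ℝ := fun x a => if a = f x then 1 else 0
  have hF : ∀ y b, gameOp (tensorKernel Ψ.payoff t) F y b =
      ∑ x, tensorKernel Ψ.payoff t x (f x) y b := fun y b => by simp [gameOp, F]
  have key := h F (fun x a => by simp only [F]; split_ifs <;> norm_num) (fun x => by simp [F])
  rw [Finset.sum_comm]
  simp only [← hF]
  refine abs_le_of_sq_le_sq' ?_ (pow_nonneg (mul_nonneg hr hE.le) t) |>.2
  -- Cauchy-Schwarz over Bob's questions: the squared value is at most the collision value.
  have hCS := sq_sum_le_card_mul_sum_sq (s := (Finset.univ : Finset (Fin t → Y)))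
    (f := fun y => gameOp (tensorKernel Ψ.payoff t) F y (g y))
  refine hCS.trans ?_
  have h1 : ∑ y, gameOp (tensorKernel Ψ.payoff t) F y (g y) ^ 2 ≤
      (r ^ 2 * (Fintype.card Y * d ^ 2)) ^ t :=
    (Finset.sum_le_sum fun y _ => Finset.single_le_sum
      (f := fun b => gameOp (tensorKernel Ψ.payoff t) F y b ^ 2)
      (fun b _ => sq_nonneg _) (Finset.mem_univ (g y))).trans key
  have h2 : ((Finset.univ : Finset (Fin t → Y)).card : ℝ) = (Fintype.card Y : ℝ) ^ t := by
    simp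
  rw [h2]
  refine (mul_le_mul_of_nonneg_left h1 (by positivity)).trans (le_of_eq ?_)
  rw [← mul_pow, hEd, ← pow_mul, mul_comm t 2, pow_mul]
  congr 1
  ring

end Value

end TwoPlayerGame

/-! ### Combining the two roundings -/

/-- For `1 - δ ≤ 1 / 16` the quadratic bound already yields the power `1 / 4`. Otherwise `log (1 -
δ) ≥ -16 δ`, and the linear bound yields a power proportional to `ε * γ`. The cubes enter only by
weakening, through `τ ^ 3 ≤ τ`. -/
theorem le_rpow_of_collision_bounds {ε γ δ ρ : ℝ} (hε : 0 < ε) (hε1 : ε ≤ 1) (hγ : 0 < γ)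
    (hγ1 : γ ≤ 1) (hδ : 0 < δ) (hδ1 : δ < 1) (h1 : ρ ^ 2 ≤ 4 * (1 - δ))
    (h2 : ρ ≤ 1 - δ * (ε * γ) / 300) :
    ρ ≤ ((1 - δ) ^ (1 / 20000 * ε ^ 3 * γ ^ 3)) ^ 2 := by
  have hs : 0 < 1 - δ := by linarith
  set τ := ε * γ with hτ
  have hτ0 : 0 < τ := mul_pos hε hγ
  have hτ1 : τ ≤ 1 := mul_le_one₀ hε1 hγ.le hγ1
  have hτ3 : τ ^ 3 ≤ τ := by nlinarith [sq_nonneg τ, mul_pos hτ0 hτ0]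
  have he : (1:ℝ) / 20000 * ε ^ 3 * γ ^ 3 = τ ^ 3 / 20000 := by rw [hτ]; ring
  rw [he, ← Real.rpow_mul_natCast hs.le]
  have hτ30 : 0 < τ ^ 3 := by positivity
  rcases le_total (1 - δ) (1 / 16) with h | h
  · have h3 : ρ ≤ (1 - δ) ^ (1 / 4 : ℝ) := by
      have hq0 : 0 ≤ (1 - δ) ^ (1 / 4 : ℝ) := by positivity
      refine abs_le_of_sq_le_sq' ?_ hq0 |>.2
      have e1 : ((1 - δ) ^ (1 / 4 : ℝ)) ^ 2 = √(1 - δ) := by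
        rw [← Real.rpow_mul_natCast hs.le, Real.sqrt_eq_rpow]; norm_num
      rw [e1]
      have h5 : √(1 - δ) ≤ 1 / 4 := by
        rw [Real.sqrt_le_left (by norm_num)]; linarith
      nlinarith [Real.sq_sqrt hs.le, Real.sqrt_nonneg (1 - δ)]
    refine h3.trans (Real.rpow_le_rpow_of_exponent_ge hs (by linarith) ?_)
    push_cast
    linarith
  · refine h2.trans ?_
    rw [Real.rpow_def_of_pos hs]
    have hlog : -(16 * δ) ≤ Real.log (1 - δ) := by
      have h3 := Real.one_sub_inv_le_log_of_pos hs
      have h4 : (1 - δ)⁻¹ ≤ 16 := by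
        rw [inv_le_comm₀ hs (by norm_num)]; linarith
      have h5 : 1 - (1 - δ)⁻¹ = -(δ * (1 - δ)⁻¹) := by field_simp; ring
      nlinarith
    have h6 := Real.add_one_le_exp (Real.log (1 - δ) * (τ ^ 3 / 20000 * (2:ℕ)))
    refine le_trans ?_ h6
    push_cast
    have h7 : -(16 * δ) * (τ ^ 3 / 20000 * 2) ≤ Real.log (1 - δ) * (τ ^ 3 / 20000 * 2) :=
      mul_le_mul_of_nonneg_right hlog (by positivity)
    nlinarith

namespace TwoPlayerGame

/-- Parallel repetition for projection games on small-set expanders. -/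
theorem value_repetition_le_of_expander {X Y A B : Type*} [Fintype X] [Fintype Y] [Finite A]
    [Finite B] [DecidableEq X] [DecidableEq Y] {Ψ : TwoPlayerGame X Y A B} (hΨ : Ψ.IsProjection)
    {d ε γ δ : ℝ} (hε : 0 < ε) (hε1 : ε ≤ 1) (hγ : 0 < γ) (hγ1 : γ ≤ 1) (hδ : 0 < δ) (hδ1 : δ < 1)
    (hrow : ∀ x, ∑ y, Ψ.edgeWeight x y = d) (hcol : ∀ y, ∑ x, Ψ.edgeWeight x y = d)
    (hexp : ∀ S : Finset (X ⊕ Y), (S.card : ℝ) ≤ ε * Fintype.card (X ⊕ Y) →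
      γ * d * S.card ≤ cutWeight (bipartiteWeight Ψ.edgeWeight) S)
    (hval : Ψ.value ≤ 1 - δ) (t : ℕ) :
    (Ψ.repetition t).value ≤ (1 - δ) ^ (1 / 20000 * ε ^ 3 * γ ^ 3 * (t : ℝ)) := by
  have := Fintype.ofFinite A
  have := Fintype.ofFinite B
  have hs : 0 < 1 - δ := by linarith
  rw [Real.rpow_mul_natCast hs.le]
  set r : ℝ := (1 - δ) ^ (1 / 20000 * ε ^ 3 * γ ^ 3) with hr
  have hr0 : 0 < r := Real.rpow_pos_of_pos hs _
  rcases Ψ.edges.eq_empty_or_nonempty with h0 | ⟨⟨x₀, y₀⟩, hxy⟩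
  · exact (value_repetition_of_edges_eq_empty _ h0 t).trans (pow_le_pow_left₀ le_rfl hr0.le t)
  have hd : 0 < d := by
    rw [← hrow x₀]
    refine Finset.sum_pos' (fun y _ => Ψ.edgeWeight_nonneg _ _) ⟨y₀, Finset.mem_univ _, ?_⟩
    simp [edgeWeight, hxy]
  have hEX : ∑ x, ∑ y, Ψ.edgeWeight x y = Fintype.card X * d := by simp [hrow]
  have hEY : ∑ x, ∑ y, Ψ.edgeWeight x y = Fintype.card Y * d := by
    rw [Finset.sum_comm]; simp [hcol]
  have hXY : (Fintype.card X : ℝ) = Fintype.card Y :=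
    mul_right_cancel₀ hd.ne' (hEX.symm.trans hEY)
  have hY : (0:ℝ) < Fintype.card Y := by
    exact_mod_cast Fintype.card_pos_iff.2 ⟨y₀⟩
  have hE : 0 < ∑ x, ∑ y, Ψ.edgeWeight x y := by rw [hEY]; positivity
  set P : ℝ := Fintype.card Y * d ^ 2 with hP
  have hP0 : 0 < P := by positivity
  have hfrac : ∀ q : X → A → ℝ, (∀ x a, 0 ≤ q x a) → (∀ x, ∑ a, q x a ≤ 1) →
      ∑ y, ∑ b, gameOp Ψ.payoff q y b ^ 2 ≤ (1 - δ) * P := fun q hq hq1 => by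
    refine (sum_gameOp_sq_le_value hΨ hd.le hcol hE hq hq1).trans ?_
    rw [hEY]
    have : d * (Ψ.value * (Fintype.card Y * d)) = Ψ.value * P := by rw [hP]; ring
    rw [this]
    exact mul_le_mul_of_nonneg_right hval hP0.le
  refine value_repetition_le hr0.le hE hEY t fun F hF hF1 => ?_
  refine sum_gameOp_tensorKernel_sq_le Ψ.payoff_nonneg (by positivity) (fun t F hF hF1 => ?_)
    t F hF hF1
  set Q := ∑ ω, ∑ y, ∑ b, gameOp Ψ.payoff (F ω) y b ^ 2 with hQ
  rw [← div_le_iff₀ hP0]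
  refine le_rpow_of_collision_bounds hε hε1 hγ hγ1 hδ hδ1 ?_ ?_
  · obtain ⟨q, hq, hq1, h⟩ := exists_labelling_of_collision Ψ.payoff_nonneg (sum_payoff_le hΨ) hcol
      F hF hF1
    rw [div_pow, div_le_iff₀ (by positivity)]
    refine h.trans ((mul_le_mul_of_nonneg_left (hfrac q hq hq1) (by positivity)).trans
      (le_of_eq ?_))
    ring
  · obtain ⟨q, hq, hq1, h⟩ := exists_labelling_of_expander Ψ.payoff_nonneg (sum_payoff_le hΨ)
      Ψ.edgeWeight_nonneg hd hε hε1 hγ hγ1 hrow hcol hexp F hF hF1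
    rw [hXY] at h
    have h1 := h.trans (hfrac q hq hq1)
    rw [div_le_iff₀ hP0]
    have hτ : 0 < ε * γ := mul_pos hε hγ
    have h2 : δ * P ≤ 300 / (ε * γ) * (P - Q) := by linarith
    rw [div_mul_eq_mul_div, le_div_iff₀ hτ] at h2
    linarith

end TwoPlayerGame

/-! ### Expansion of graphs and of double covers -/

section Graphs

variable {V : Type*} (G : SimpleGraph V)

open Classical in
/-- The adjacency kernel of a graph. -/
noncomputable def adjWeight (v w : V) : ℝ := if G.Adj v w then 1 else 0

variable {G}

theorem adjWeight_comm (v w : V) : adjWeight G v w = adjWeight G w v := by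
  by_cases h : G.Adj v w
  · simp [adjWeight, h, h.symm]
  · have h' : ¬ G.Adj w v := fun h' => h h'.symm
    simp [adjWeight, h, h']

theorem adjWeight_nonneg (v w : V) : 0 ≤ adjWeight G v w := by
  unfold adjWeight; split_ifs <;> norm_num

variable [Fintype V]

theorem sum_adjWeight [G.LocallyFinite] {d : ℕ} (hG : G.IsRegularOfDegree d) (v : V) :
    ∑ w, adjWeight G v w = d := by
  classical
  simp only [adjWeight, Finset.sum_boole]
  rw [← hG v, ← G.card_neighborFinset_eq_degree v]
  congr 2
  ext w; simp

/-- Clearing the denominator `d * S.card` of the expansion also covers the empty set and degree `0`.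
-/
theorem IsSmallSetExpander.le_cutWeight [DecidableEq V] [G.LocallyFinite] {d : ℕ} {ε γ : ℝ}
    (hG : G.IsRegularOfDegree d) (h : IsSmallSetExpander G ε γ) (S : Finset V)
    (hS : (S.card : ℝ) ≤ ε * Fintype.card V) :
    γ * d * S.card ≤ cutWeight (adjWeight G) S := by
  classical
  have hcut : ∀ (P : V → V → Prop) [∀ v w, Decidable (P v w)],
      (Set.ncard {p : V × V | G.Adj p.1 p.2 ∧ P p.1 p.2} : ℝ) =
      ∑ v, ∑ w, if P v w then adjWeight G v w else 0 := fun P _ => by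
    rw [← Fintype.sum_prod_type' (f := fun v w => if P v w then adjWeight G v w else 0)]
    simp only [adjWeight, ← ite_and, Finset.sum_boole]
    rw [Set.ncard_eq_toFinset_card']
    congr 2
    ext; simp [and_comm]
  rcases S.eq_empty_or_nonempty with rfl | hne
  · simp [cutWeight]
  have hexp := h S hne hS
  rw [edgeExpansion, hcut fun v w => v ∈ S ∧ w ∉ S, hcut fun v _ => v ∈ S] at hexp
  have hden : (∑ v, ∑ w, if v ∈ S then adjWeight G v w else 0) = d * S.card := by
    have : ∀ v, (∑ w, if v ∈ S then adjWeight G v w else 0) = if v ∈ S then (d:ℝ) else 0 :=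
      fun v => by split_ifs <;> simp [sum_adjWeight hG]
    simp [this, mul_comm]
  rw [hden] at hexp
  have hcut0 : 0 ≤ cutWeight (adjWeight G) S :=
    Finset.sum_nonneg fun _ _ => Finset.sum_nonneg fun _ _ => by
      split_ifs
      exacts [adjWeight_nonneg _ _, le_rfl]
  rcases (show (0:ℝ) ≤ d * S.card by positivity).eq_or_lt with h0 | hpos
  · rw [mul_assoc, ← h0, mul_zero]; exact hcut0
  · rw [mul_assoc]
    exact (le_div_iff₀ hpos).1 hexp

/-- The bipartite double cover of a small-set expander is a small-set expander. -/
theorem IsSmallSetExpander.le_cutWeight_doubleCover [DecidableEq V] [G.LocallyFinite] {d : ℕ}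
    {ε γ : ℝ} (hG : G.IsRegularOfDegree d) (h : IsSmallSetExpander G ε γ) (S : Finset (V ⊕ V))
    (hS : (S.card : ℝ) ≤ ε / 2 * Fintype.card (V ⊕ V)) :
    γ * d * S.card ≤ cutWeight (bipartiteWeight (adjWeight G)) S := by
  set L := S.toLeft
  set R := S.toRight
  have hcard : L.card + R.card = S.card := Finset.card_toLeft_add_card_toRight
  have hcard' : (L ∪ R).card + (L ∩ R).card = S.card := by
    rw [Finset.card_union_add_card_inter, hcard]
  have hS' : (S.card : ℝ) ≤ ε * Fintype.card V := by
    rw [Fintype.card_sum] at hS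
    push_cast at hS
    linarith
  have hU := h.le_cutWeight hG (L ∪ R) (le_trans (by exact_mod_cast (by omega)) hS')
  have hI := h.le_cutWeight hG (L ∩ R) (le_trans (by exact_mod_cast (by omega)) hS')
  -- Submodularity: the cut of `S` in the double cover counts edges from `L` to outside `R` and from
  -- `R` to outside `L`, and uncrossing to union and intersection does not increase the total.
  have hsum : cutWeight (adjWeight G) (L ∪ R) + cutWeight (adjWeight G) (L ∩ R) ≤
      cutWeight (bipartiteWeight (adjWeight G)) S := by
    have e : cutWeight (bipartiteWeight (adjWeight G)) S =
        ∑ v, ∑ w, ((if v ∈ L ∧ w ∉ R then adjWeight G v w else 0) +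
          if v ∈ R ∧ w ∉ L then adjWeight G v w else 0) := by
      simp only [cutWeight, Fintype.sum_sum_type, bipartiteWeight, ite_self,
        Finset.sum_const_zero, zero_add, add_zero, Finset.sum_add_distrib, L, R,
        Finset.mem_toLeft, Finset.mem_toRight]
      rw [add_comm]
      congr 1
      refine Finset.sum_congr rfl fun v _ => Finset.sum_congr rfl fun w _ => ?_
      rw [adjWeight_comm]
    rw [e, cutWeight, cutWeight]
    simp only [← Finset.sum_add_distrib]
    refine Finset.sum_le_sum fun v _ => Finset.sum_le_sum fun w _ => ?_
    have := adjWeight_nonneg (G := G) v w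
    simp only [Finset.mem_union, Finset.mem_inter]
    by_cases h1 : v ∈ L <;> by_cases h2 : v ∈ R <;> by_cases h3 : w ∈ L <;>
      by_cases h4 : w ∈ R <;> simp [h1, h2, h3, h4, this]
  have hc : ((L ∪ R).card : ℝ) + (L ∩ R).card = S.card := by exact_mod_cast hcard'
  calc γ * d * S.card = γ * d * (L ∪ R).card + γ * d * (L ∩ R).card := by rw [← hc]; ring
    _ ≤ _ := (add_le_add hU hI).trans hsum

end Graphs

theorem UniqueGame.isProjection_game {V A : Type*} {G : SimpleGraph V} (Ψ : UniqueGame G A) :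
    Ψ.game.IsProjection := by
  classical
  intro u v huv
  refine ⟨fun a => if h : ∃ b, Ψ.constraint u v a b then some h.choose else none, fun a b => ?_⟩
  change Ψ.constraint u v a b ↔ _
  dsimp only
  constructor
  · intro hab
    have h : ∃ b, Ψ.constraint u v a b := ⟨b, hab⟩
    rw [dif_pos h]
    exact congrArg some (Ψ.right_unique u v huv a _ _ h.choose_spec hab)
  · intro hab
    split_ifs at hab with h
    rw [← Option.some_injective _ hab]
    exact h.choose_spec

theorem UniqueGame.edgeWeight_game {V A : Type*} {G : SimpleGraph V}
    (Ψ : UniqueGame G A) : Ψ.game.edgeWeight = adjWeight G := rfl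

theorem TwoPlayerGame.adjWeight_graph {X Y A B : Type*}
    (Ψ : TwoPlayerGame X Y A B) : adjWeight Ψ.graph = bipartiteWeight Ψ.edgeWeight := by
  classical
  funext w w'
  cases w <;> cases w' <;>
    simp [adjWeight, bipartiteWeight, edgeWeight, graph, SimpleGraph.fromRel_adj]

/-! ### The main theorem -/

theorem theorem1p6 :
    ∃ c : ℝ, 0 < c ∧
      ∀ ε γ δ : ℝ, 0 < ε → ε < 1 → 0 < γ → γ < 1 → 0 < δ → δ < 1 →
        -- Unique-Games instances on a regular small-set expander
        (∀ (V A : Type*) [Fintype V] [Finite A] (G : SimpleGraph V) [G.LocallyFinite] (d : ℕ)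
            (Ψ : UniqueGame G A),
          G.IsRegularOfDegree d → IsSmallSetExpander G ε γ → Ψ.game.value ≤ 1 - δ →
          ∀ t : ℕ, (Ψ.game.repetition t).value ≤ (1 - δ) ^ (c * ε ^ 3 * γ ^ 3 * (t : ℝ))) ∧
        -- projection games whose bipartite graph is a regular small-set expander
        (∀ (X Y A B : Type*) [Fintype X] [Fintype Y] [Finite A] [Finite B]
            (Ψ : TwoPlayerGame X Y A B) [Ψ.graph.LocallyFinite] (d : ℕ),
          Ψ.IsProjection → Ψ.graph.IsRegularOfDegree d →
          IsSmallSetExpander Ψ.graph ε γ → Ψ.value ≤ 1 - δ →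
          ∀ t : ℕ, (Ψ.repetition t).value ≤ (1 - δ) ^ (c * ε ^ 3 * γ ^ 3 * (t : ℝ))) := by
  classical
  -- The constant is `1 / 20000` divided by `2 ^ 3`, because passing to the double cover halves `ε`.
  refine ⟨1 / 160000, by norm_num, fun ε γ δ hε hε1 hγ hγ1 hδ hδ1 => ⟨?_, ?_⟩⟩
  · intro V A _ _ G _ d Ψ hG hexp hval t
    have hrow : ∀ v, ∑ w, Ψ.game.edgeWeight v w = d := sum_adjWeight hG
    have hcol : ∀ w, ∑ v, Ψ.game.edgeWeight v w = d := fun w => by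
      rw [Ψ.edgeWeight_game, ← sum_adjWeight hG w]
      exact Finset.sum_congr rfl fun v _ => adjWeight_comm _ _
    refine (TwoPlayerGame.value_repetition_le_of_expander Ψ.isProjection_game (half_pos hε)
      (by linarith) hγ hγ1.le hδ hδ1 hrow hcol (hexp.le_cutWeight_doubleCover hG) hval t).trans
      (le_of_eq ?_)
    congr 1
    ring
  · intro X Y A B _ _ _ _ Ψ _ d hΨ hG hexp hval t
    have hsum : ∀ w, ∑ w', bipartiteWeight Ψ.edgeWeight w w' = d := fun w => by
      rw [← Ψ.adjWeight_graph]; exact sum_adjWeight hG w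
    have hrow : ∀ x, ∑ y, Ψ.edgeWeight x y = d := fun x => by
      simpa [Fintype.sum_sum_type, bipartiteWeight] using hsum (.inl x)
    have hcol : ∀ y, ∑ x, Ψ.edgeWeight x y = d := fun y => by
      simpa [Fintype.sum_sum_type, bipartiteWeight] using hsum (.inr y)
    refine (TwoPlayerGame.value_repetition_le_of_expander hΨ hε hε1.le hγ hγ1.le hδ hδ1 hrow hcol
      (fun S hS => by rw [← Ψ.adjWeight_graph]; exact hexp.le_cutWeight hG S hS) hval t).trans ?_
    refine Real.rpow_le_rpow_of_exponent_ge (by linarith) (by linarith) ?_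
    gcongr
    norm_num
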